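/- **Conventions.** Let $X$ be a diffeological space. $\Omega^1(X)$ is the vector space of diffeological differential 1-forms on $X$, with its functional diffeology, and $\Lambda^1_x(X)=\Omega^1(X)/\Omega^1_x(X)$, where $\Omega^1_x(X)$ is the subspace of the forms $\omega$ vanishing at $x$ (that is, $\omega(p)(0)=0$ for every plot $p$ with $p(0)=x$). $\Lambda^1(X)=\bigsqcup_x\Lambda^1_x(X)$ carries the pushforward of the product diffeology of $X\times\Omega^1(X)$ by $(x,\omega)\mapsto\omega(x)$, and $\Lambda^1(X)\otimes\Lambda^1(X)$ the tensor product diffeology. The differential $dh$ of a smooth function $h:X\to\mathbb R$ is regarded as a smooth section of $\Lambda^1(X)$. A smooth map $h:A\to B$ induces, by pullback of forms, linear maps $h_\Lambda^*:\Lambda^1_{h(a)}(B)\to\Lambda^1_a(A)$. A *pseudo-metric* on $\Lambda^1(X)$, whose fibres are then required to be finite-dimensional, is a smooth family $g$ of symmetric positive semidefinite bilinear forms on the fibres $\Lambda^1_x(X)$ such that the nullity of $g(x)$ equals $\dim\Lambda^1_x(X)$ minus the dimension of the diffeological dual (the space of smooth linear functionals) of $\Lambda^1_x(X)$. A *connection*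 on $\Lambda^1(X)$ is a linear operator $\nabla:C^\infty(X,\Lambda^1(X))\to C^\infty(X,\Lambda^1(X)\otimes\Lambda^1(X))$, smooth for the functional diffeologies, with $\nabla(hs)=dh\otimes s+h\nabla s$ for all smooth functions $h$ and sections $s$. Given $g$, put $g(\omega\otimes s,t)=g(s,\omega\otimes t)=g(s,t)\,\omega$; $t(h)=g(t,dh)$ for a section $t$ and a smooth function $h$; and let $\nabla_ts$ be the contraction of the first factor of $\nabla s$ with $g(t,\cdot)$. The connection is *metric* if $d(g(s,t))=g(\nabla s,t)+g(s,\nabla t)$ for all smooth sections $s,t$; it is *symmetric* if $\nabla_st-\nabla_ts=[s,t]$ for all smooth sections $s,t$, where the bracket is given by its action on functions, i.e. if $(\nabla_st-\nabla_ts)(h)=s(t(h))-t(s(h))$ for every smooth function $h$. A *Levi-Civita connection* on $(\Lambda^1(X),g)$ is a connection that is metric and symmetric. **Gluing.** Let $X_1,X_2$ be diffeological spaces, $Y\subseteq X_1$, and let $f:Y\to X_2$ be a diffeomorphism onto its image (subset diffeologies); let $i:Y\to X_1$ and $j:f(Y)\to X_2$ be the inclusions. $X_1\cup_fX_2$ is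 the quotient of $X_1\sqcup X_2$ by $y\sim f(y)$, $y\in Y$, with the quotient diffeology; $\tilde i_1:X_1\to X_1\cup_fX_2$ and $i_2:X_2\to X_1\cup_fX_2$ are the natural maps, and $\tilde\rho_1=(\tilde i_1)^*_\Lambda$, $\tilde\rho_2=(i_2)^*_\Lambda$ (fibrewise linear maps from the fibres of $\Lambda^1(X_1\cup_fX_2)$ to those of $\Lambda^1(X_1)$, $\Lambda^1(X_2)$). $\mathcal D_1^\Omega$ and $\mathcal D_2^\Omega$ are the diffeologies on $\Omega^1(Y)$ obtained by pushing forward the diffeologies of $\Omega^1(X_1)$ and $\Omega^1(X_2)$ by $i^*$ and $f^*j^*$. For $y\in Y$, elements $\alpha_1\in\Lambda^1_y(X_1)$ and $\alpha_2\in\Lambda^1_{f(y)}(X_2)$ are *compatible* if $i_\Lambda^*\alpha_1=f_\Lambda^*j_\Lambda^*\alpha_2$ in $\Lambda^1_y(Y)$. Pseudo-metrics $g_1,g_2$ on $\Lambda^1(X_1),\Lambda^1(X_2)$ are *compatible* if $g_1(y)(\alpha_1,\beta_1)=g_2(f(y))(\alpha_2,\beta_2)$ for all $y\in Y$ and all compatible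 pairs $(\alpha_1,\alpha_2)$, $(\beta_1,\beta_2)$ over $y$. Connections $\nabla^1,\nabla^2$ on $\Lambda^1(X_1),\Lambda^1(X_2)$ are *compatible* if $(i_\Lambda^*\otimes i_\Lambda^*)\big((\nabla^1s_1)(y)\big)=(f_\Lambda^*j_\Lambda^*\otimes f_\Lambda^*j_\Lambda^*)\big((\nabla^2s_2)(f(y))\big)$ for every $y\in Y$ and all smooth sections $s_1,s_2$ with $s_1(y')$ and $s_2(f(y'))$ compatible for all $y'\in Y$. **Theorem.** Suppose that $\mathcal D_1^\Omega=\mathcal D_2^\Omega$, let $g_1,g_2$ be compatible pseudo-metrics on $\Lambda^1(X_1)$ and $\Lambda^1(X_2)$, and let $\nabla^1,\nabla^2$ be Levi-Civita connections on $(\Lambda^1(X_1),g_1)$ and $(\Lambda^1(X_2),g_2)$ that are compatible with each other. Then: 1. there is a pseudo-metric $g^\Lambda$ on $\Lambda^1(X_1\cup_fX_2)$ given by $g_1(\tilde\rho_1\cdot,\tilde\rho_1\cdot)$ over $\tilde i_1(X_1\setminus Y)$, by $g_2(\tilde\rho_2\cdot,\tilde\rho_2\cdot)$ over $i_2(X_2\setminus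 f(Y))$, and by $\tfrac12\big(g_1(\tilde\rho_1\cdot,\tilde\rho_1\cdot)+g_2(\tilde\rho_2\cdot,\tilde\rho_2\cdot)\big)$ over $i_2(f(Y))$; 2. there is exactly one operator $\nabla_\cup$ assigning to each smooth section $s$ of $\Lambda^1(X_1\cup_fX_2)$ a section of $\Lambda^1(X_1\cup_fX_2)\otimes\Lambda^1(X_1\cup_fX_2)$ such that, with $s_1=\tilde\rho_1\circ s\circ\tilde i_1$ and $s_2=\tilde\rho_2\circ s\circ i_2$, the map $\tilde\rho_1\otimes\tilde\rho_1$ carries $(\nabla_\cup s)(\tilde i_1(x))$ to $(\nabla^1s_1)(x)$ for $x\in X_1\setminus Y$, the map $\tilde\rho_2\otimes\tilde\rho_2$ carries $(\nabla_\cup s)(i_2(x))$ to $(\nabla^2s_2)(x)$ for $x\in X_2\setminus f(Y)$, and, for $y\in Y$, they carry $(\nabla_\cup s)(i_2(f(y)))$ to $(\nabla^1s_1)(y)$ and to $(\nabla^2s_2)(f(y))$ respectively; and $\nabla_\cup$ is a connection on $\Lambda^1(X_1\cup_fX_2)$; 3. $\nabla_\cup$ is a Levi-Civita connection on $(\Lambda^1(X_1\cup_fX_2),g^\Lambda)$,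 i.e. it is metric and symmetric. -/

import Mathlib

open Diffeology Topology
open scoped ContDiff TensorProduct

noncomputable section

namespace DiffGlue

universe u v

/-- The Euclidean spaces on which plots are defined. -/
abbrev E (n : ℕ) : Type := EuclideanSpace ℝ (Fin n)

/-! ### Constructing diffeologies -/

section Generation

/-- Inside an open neighbourhood of a point there is a smooth map of the whole Euclidean space into
that neighbourhood which is the identity near the point. -/
theorem exists_squash {n : ℕ} {U : Set (E n)} (hU : IsOpen U) {x : E n} (hx : x ∈ U) :
    ∃ φ : E n → E n, ContDiff ℝ ∞ φ ∧ (∀ y, φ y ∈ U) ∧ ∀ᶠ y in 𝓝 x, φ y = y := by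
  obtain ⟨ε, hε, hεU⟩ := Metric.isOpen_iff.mp hU x hx
  let b : ContDiffBump x := ⟨ε / 4, ε / 2, by positivity, by linarith⟩
  refine ⟨fun y => x + b y • (y - x), ?_, ?_, ?_⟩
  · exact contDiff_const.add (b.contDiff.smul (contDiff_id.sub contDiff_const))
  · intro y
    apply hεU
    rw [Metric.mem_ball, dist_eq_norm, add_sub_cancel_left, norm_smul, Real.norm_eq_abs,
      abs_of_nonneg b.nonneg]
    by_cases hy : dist y x < ε / 2
    · rw [dist_eq_norm] at hy
      nlinarith [b.nonneg (x := y), b.le_one (x := y), norm_nonneg (y - x)]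
    · rw [b.zero_of_le_dist (not_lt.mp hy)]
      simpa using hε
  · filter_upwards [b.eventuallyEq_one] with y hy
    rw [hy]
    simp

/-- The diffeology whose plots are the maps that locally agree with a member of a family `P` of
maps containing the constants and closed under smooth reparametrisation. -/
@[reducible]
def generated {X : Type u} (P : ∀ n : ℕ, Set (E n → X))
    (hc : ∀ (n : ℕ) (x : X), (fun _ => x) ∈ P n)
    (hr : ∀ (n m : ℕ) (p : E m → X) (f : E n → E m), p ∈ P m → ContDiff ℝ ∞ f → p ∘ f ∈ P n) :
    DiffeologicalSpace X where
  plots n := {q | ∀ x, ∃ p ∈ P n, q =ᶠ[𝓝 x] p}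
  constant_plots x := fun _ => ⟨_, hc _ x, Filter.EventuallyEq.rfl⟩
  plot_reparam := by
    intro n m p f hp hf x
    obtain ⟨p', hp', h⟩ := hp (f x)
    exact ⟨p' ∘ f, hr _ _ _ _ hp' hf, hf.continuous.continuousAt.eventually h⟩
  locality := by
    intro n p hp x
    obtain ⟨U, hU, hxU, h⟩ := hp x
    obtain ⟨φ, hφ, hφU, hφx⟩ := exists_squash hU hxU
    obtain ⟨p', hp', h'⟩ := h hφU hφ x
    refine ⟨p', hp', ?_⟩
    filter_upwards [h', hφx] with y hy hy'
    rw [← hy, Function.comp_apply, hy']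

/-- The pushforward diffeology by `F`: locally a plot lifts to a plot through `F`, or is
constant. -/
@[reducible]
def pushforward {X : Type u} {Z : Type v} [DiffeologicalSpace X] (F : X → Z) :
    DiffeologicalSpace Z :=
  generated (fun n => {q | (∃ p : E n → X, IsPlot p ∧ q = F ∘ p) ∨ ∃ z, q = fun _ => z})
    (fun _ z => Or.inr ⟨z, rfl⟩) (by
      rintro n m _ f (⟨p, hp, rfl⟩ | ⟨z, rfl⟩) hf
      · exact Or.inl ⟨p ∘ f, isPlot_reparam hp hf, rfl⟩
      · exact Or.inr ⟨z, rfl⟩)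

/-- The pullback diffeology by `F`: plots are the maps whose composition with `F` is a plot. -/
@[reducible]
def pullbackDiffeology {X : Type u} {Z : Type v} [DiffeologicalSpace Z] (F : X → Z) :
    DiffeologicalSpace X where
  plots n := {p : E n → X | IsPlot (F ∘ p)}
  constant_plots x := (isPlot_const : IsPlot (fun _ => F x))
  plot_reparam hp hf := isPlot_reparam hp hf
  locality := by
    intro n p hp
    exact DiffeologicalSpace.locality (p := F ∘ p) hp

/-- Subsets carry the subset diffeology. -/
instance subsetDiffeology {X : Type u} [DiffeologicalSpace X] (Y : Set X) :
    DiffeologicalSpace Y :=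
  pullbackDiffeology Subtype.val

/-- The disjoint union diffeology. -/
instance sumDiffeology {X : Type u} {Z : Type v} [DiffeologicalSpace X] [DiffeologicalSpace Z] :
    DiffeologicalSpace (X ⊕ Z) :=
  generated (fun n => {q | (∃ p : E n → X, IsPlot p ∧ q = Sum.inl ∘ p) ∨
      ∃ p : E n → Z, IsPlot p ∧ q = Sum.inr ∘ p})
    (by
      rintro n (x | z)
      · exact Or.inl ⟨fun _ => x, isPlot_const, rfl⟩
      · exact Or.inr ⟨fun _ => z, isPlot_const, rfl⟩)
    (by
      rintro n m _ f (⟨p, hp, rfl⟩ | ⟨p, hp, rfl⟩) hf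
      · exact Or.inl ⟨p ∘ f, isPlot_reparam hp hf, rfl⟩
      · exact Or.inr ⟨p ∘ f, isPlot_reparam hp hf, rfl⟩)

theorem isPlot_of_locally {X : Type u} [DiffeologicalSpace X] {n : ℕ} {q : E n → X}
    (h : ∀ x, ∃ p : E n → X, IsPlot p ∧ q =ᶠ[𝓝 x] p) : IsPlot q := by
  refine DiffeologicalSpace.locality fun x => ?_
  obtain ⟨p, hp, hx⟩ := h x
  obtain ⟨U, hU, hUo, hxU⟩ := eventually_nhds_iff.mp hx
  refine ⟨U, hUo, hxU, fun {m f} hf hfs => ?_⟩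
  have : q ∘ f = p ∘ f := funext fun y => hU _ (hf y)
  rw [this]
  exact isPlot_reparam hp hfs

theorem dSmooth_val {X : Type u} [DiffeologicalSpace X] (Y : Set X) :
    DSmooth (Subtype.val : Y → X) :=
  fun _ _ hp => hp

theorem dSmooth_pushforward {X : Type u} {Z : Type v} [DiffeologicalSpace X] (F : X → Z) :
    @DSmooth X Z _ (pushforward F) F :=
  fun _ p hp _ => ⟨F ∘ p, Or.inl ⟨p, hp, rfl⟩, Filter.EventuallyEq.rfl⟩

end Generation

/-! ### Smooth functions -/

/-- The algebra of smooth real functions on a diffeological space. -/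
def smoothFunctions (X : Type u) [DiffeologicalSpace X] : Subalgebra ℝ (X → ℝ) where
  carrier := {h | DSmooth h}
  mul_mem' := fun {a b} ha hb n p hp => by
    have h1 := isPlot_iff_contDiff.mp (ha n p hp)
    have h2 := isPlot_iff_contDiff.mp (hb n p hp)
    exact isPlot_iff_contDiff.mpr (h1.mul h2)
  add_mem' := fun {a b} ha hb n p hp => by
    have h1 := isPlot_iff_contDiff.mp (ha n p hp)
    have h2 := isPlot_iff_contDiff.mp (hb n p hp)
    exact isPlot_iff_contDiff.mpr (h1.add h2)
  algebraMap_mem' := fun r => (dSmooth_const : DSmooth fun _ : X => r)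

theorem smoothFunctions_comp {X : Type u} [DiffeologicalSpace X] (h : smoothFunctions X) {n : ℕ}
    {p : E n → X} (hp : IsPlot p) : ContDiff ℝ ∞ (h.1 ∘ p) :=
  isPlot_iff_contDiff.mp (h.2 n p hp)

/-! ### Differential forms of degree one -/

/-- The plots of `X` with domain `E n`. -/
abbrev Plot (X : Type u) [DiffeologicalSpace X] (n : ℕ) : Type u := {p : E n → X // IsPlot p}

/-- The vector space of diffeological differential `1`-forms: a form assigns to each plot
`p : E n → X` a smooth `1`-form on `E n`, compatibly with smooth reparametrisations. -/
def omegaSubmodule (X : Type u) [DiffeologicalSpace X] :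
    Submodule ℝ (∀ n : ℕ, Plot X n → E n → (E n →L[ℝ] ℝ)) where
  carrier := {α | (∀ (n : ℕ) (p : Plot X n), ContDiff ℝ ∞ (α n p)) ∧
    ∀ (n m : ℕ) (p : Plot X m) (f : E n → E m) (hf : ContDiff ℝ ∞ f) (r : E n),
      α n ⟨p.1 ∘ f, isPlot_reparam p.2 hf⟩ r = (α m p (f r)).comp (fderiv ℝ f r)}
  add_mem' := by
    rintro α β ⟨hα, hα'⟩ ⟨hβ, hβ'⟩
    refine ⟨fun n p => (hα n p).add (hβ n p), fun n m p f hf r => ?_⟩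
    simp only [Pi.add_apply, hα' n m p f hf r, hβ' n m p f hf r, ContinuousLinearMap.add_comp]
  zero_mem' := by
    refine ⟨fun n p => contDiff_const, fun n m p f hf r => ?_⟩
    simp
  smul_mem' := by
    rintro c α ⟨hα, hα'⟩
    refine ⟨fun n p => (contDiff_const (c := c)).smul (hα n p), fun n m p f hf r => ?_⟩
    simp only [Pi.smul_apply, hα' n m p f hf r, ContinuousLinearMap.smul_comp]

/-- The vector space `Ω¹(X)`. -/
def Omega1 (X : Type u) [DiffeologicalSpace X] : Type u := omegaSubmodule X

instance (X : Type u) [DiffeologicalSpace X] : AddCommGroup (Omega1 X) :=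
  inferInstanceAs (AddCommGroup (omegaSubmodule X))

instance (X : Type u) [DiffeologicalSpace X] : Module ℝ (Omega1 X) :=
  inferInstanceAs (Module ℝ (omegaSubmodule X))

@[simp]
theorem omega_add {X : Type u} [DiffeologicalSpace X] (α β : Omega1 X) :
    (α + β).1 = α.1 + β.1 :=
  rfl

@[simp]
theorem omega_smul {X : Type u} [DiffeologicalSpace X] (c : ℝ) (α : Omega1 X) :
    (c • α).1 = c • α.1 :=
  rfl

/-- The functional diffeology on `Ω¹(X)`: a family `θ` of forms is a plot when, for every plot `p`
of `X`, the form `θ(s)(p)(r)` depends smoothly on `(s, r)`. -/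
instance omegaDiffeology (X : Type u) [DiffeologicalSpace X] : DiffeologicalSpace (Omega1 X) where
  plots m := {θ | ∀ (n : ℕ) (p : Plot X n),
    ContDiff ℝ ∞ (fun z : E m × E n => (θ z.1).1 n p z.2)}
  constant_plots := fun α n p => (α.2.1 n p).comp contDiff_snd
  plot_reparam := fun hθ hf n p =>
    (hθ n p).comp ((hf.comp contDiff_fst).prodMk contDiff_snd)
  locality := by
    intro m θ hθ n p
    rw [contDiff_iff_contDiffAt]
    rintro ⟨s, r⟩
    obtain ⟨U, hU, hsU, h⟩ := hθ s
    obtain ⟨φ, hφ, hφU, hφs⟩ := exists_squash hU hsU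
    refine ((h hφU hφ n p).contDiffAt (x := (s, r))).congr_of_eventuallyEq ?_
    filter_upwards [(continuous_fst.tendsto (s, r)).eventually hφs] with z hz
    simp [hz]

theorem isPlot_omega_iff {X : Type u} [DiffeologicalSpace X] {m : ℕ} {θ : E m → Omega1 X} :
    IsPlot θ ↔ ∀ (n : ℕ) (p : Plot X n), ContDiff ℝ ∞ fun z : E m × E n => (θ z.1).1 n p z.2 :=
  Iff.rfl

/-- The pullback of forms by a smooth map. -/
def pullback {A : Type u} {B : Type v} [DiffeologicalSpace A] [DiffeologicalSpace B] (h : A → B)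
    (hh : DSmooth h) : Omega1 B →ₗ[ℝ] Omega1 A where
  toFun α := ⟨fun n p => α.1 n ⟨h ∘ p.1, hh n p.1 p.2⟩,
    fun n p => α.2.1 n _, fun n m p f hf r => α.2.2 n m ⟨h ∘ p.1, hh m p.1 p.2⟩ f hf r⟩
  map_add' _ _ := rfl
  map_smul' _ _ := rfl

/-- The differential of a smooth function, as a `1`-form. -/
def differential {X : Type u} [DiffeologicalSpace X] (h : smoothFunctions X) : Omega1 X :=
  ⟨fun _ p => fderiv ℝ (h.1 ∘ p.1),
    fun _ p => (smoothFunctions_comp h p.2).fderiv_right (m := ∞) (by simp), by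
      intro n m p f hf r
      exact fderiv_comp r ((smoothFunctions_comp h p.2).differentiable (by simp) _)
        (hf.differentiable (by simp) r)⟩

/-- The forms vanishing at `x`: those whose value at `0` is zero on every plot sending `0`
to `x`. -/
def vanishing {X : Type u} [DiffeologicalSpace X] (x : X) : Submodule ℝ (Omega1 X) where
  carrier := {α | ∀ (n : ℕ) (p : Plot X n), p.1 0 = x → α.1 n p 0 = 0}
  add_mem' := by
    intro α β hα hβ n p hp
    simp [hα n p hp, hβ n p hp]
  zero_mem' := by
    intro _ _ _
    rfl
  smul_mem' := by
    intro c α hα n p hp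
    simp [hα n p hp]

/-! ### The pseudo-bundle of values of `1`-forms -/

/-- The fibre `Λ¹_x(X)`: forms modulo forms vanishing at `x`. -/
abbrev Lam {X : Type u} [DiffeologicalSpace X] (x : X) : Type u := Omega1 X ⧸ vanishing x

/-- The value at `x` of a form. -/
abbrev val {X : Type u} [DiffeologicalSpace X] (x : X) : Omega1 X →ₗ[ℝ] Lam x :=
  (vanishing x).mkQ

/-- The total space `Λ¹(X)`. -/
structure LamTotal (X : Type u) [DiffeologicalSpace X] : Type u where
  /-- The base point. -/
  base : X
  /-- The element of the fibre. -/
  vec : Lam base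

/-- `Λ¹(X)` carries the pushforward of the product diffeology of `X × Ω¹(X)` by
`(x, θ) ↦ θ(x)`. -/
instance lamDiffeology (X : Type u) [DiffeologicalSpace X] : DiffeologicalSpace (LamTotal X) :=
  generated (fun n => {q | ∃ (p : E n → X) (θ : E n → Omega1 X),
      IsPlot p ∧ IsPlot θ ∧ q = fun r => ⟨p r, val (p r) (θ r)⟩})
    (by
      rintro n ⟨x, v⟩
      obtain ⟨α, rfl⟩ := (vanishing x).mkQ_surjective v
      exact ⟨fun _ => x, fun _ => α, isPlot_const, isPlot_const, rfl⟩)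
    (by
      rintro n m _ f ⟨p, θ, hp, hθ, rfl⟩ hf
      exact ⟨p ∘ f, θ ∘ f, isPlot_reparam hp hf, isPlot_reparam hθ hf, rfl⟩)

/-- A family `v` of elements of `Λ¹(X)` over the family `b` of base points is smooth. -/
def SmoothAlong {X : Type u} [DiffeologicalSpace X] {n : ℕ} (b : E n → X)
    (v : ∀ r, Lam (b r)) : Prop :=
  IsPlot (fun r => (⟨b r, v r⟩ : LamTotal X))

/-- The fibre `Λ¹_x(X)` carries the subset diffeology. -/
instance lamFibreDiffeology {X : Type u} [DiffeologicalSpace X] (x : X) :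
    DiffeologicalSpace (Lam x) :=
  pullbackDiffeology (fun v : Lam x => (⟨x, v⟩ : LamTotal X))

theorem smoothAlong_iff {X : Type u} [DiffeologicalSpace X] {n : ℕ} {b : E n → X}
    {v : ∀ r, Lam (b r)} : SmoothAlong b v ↔ IsPlot b ∧
      ∀ r₀, ∃ θ : E n → Omega1 X, IsPlot θ ∧ ∀ᶠ r in 𝓝 r₀, v r = val (b r) (θ r) := by
  constructor
  · intro h
    refine ⟨isPlot_of_locally fun r₀ => ?_, fun r₀ => ?_⟩
    · obtain ⟨_, ⟨p, θ, hp, hθ, rfl⟩, hq⟩ := h r₀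
      exact ⟨p, hp, hq.mono fun r hr => congrArg LamTotal.base hr⟩
    · obtain ⟨_, ⟨p, θ, hp, hθ, rfl⟩, hq⟩ := h r₀
      refine ⟨θ, hθ, hq.mono fun r hr => ?_⟩
      obtain ⟨h1, h2⟩ := LamTotal.mk.inj hr
      rw [← h1] at h2
      exact eq_of_heq h2
  · rintro ⟨hb, h⟩ r₀
    obtain ⟨θ, hθ, hr⟩ := h r₀
    refine ⟨_, ⟨b, θ, hb, hθ, rfl⟩, hr.mono fun r hr => ?_⟩
    simp only [hr]

/-- The linear map `Λ¹_b(B) → Λ¹_a(A)` induced by the pullback of forms by a smooth map `h` with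
`h a = b`. -/
def lamMap {A : Type u} {B : Type v} [DiffeologicalSpace A] [DiffeologicalSpace B] (h : A → B)
    (hh : DSmooth h) (a : A) (b : B) (hab : h a = b) : Lam b →ₗ[ℝ] Lam a :=
  (vanishing b).mapQ (vanishing a) (pullback h hh) (by
    intro α hα n p hp
    exact hα n ⟨h ∘ p.1, hh n p.1 p.2⟩ (by simp [hp, hab]))

/-- The smooth linear functionals on the fibre `Λ¹_x(X)` (its diffeological dual). -/
def smoothDual {X : Type u} [DiffeologicalSpace X] (x : X) :
    Submodule ℝ (Module.Dual ℝ (Lam x)) where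
  carrier := {φ | DSmooth fun v : Lam x => φ v}
  add_mem' := fun {a b} ha hb n p hp => by
    have h1 := isPlot_iff_contDiff.mp (ha n p hp)
    have h2 := isPlot_iff_contDiff.mp (hb n p hp)
    exact isPlot_iff_contDiff.mpr (h1.add h2)
  zero_mem' := (dSmooth_const : DSmooth fun _ : Lam x => (0 : ℝ))
  smul_mem' := fun c a ha n p hp => by
    have h1 := isPlot_iff_contDiff.mp (ha n p hp)
    exact isPlot_iff_contDiff.mpr (contDiff_const.smul h1)

/-! ### The tensor square of `Λ¹(X)` -/

/-- The fibre `Λ¹_x(X) ⊗ Λ¹_x(X)`. -/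
abbrev Lam2 {X : Type u} [DiffeologicalSpace X] (x : X) : Type u := Lam x ⊗[ℝ] Lam x

/-- The total space `Λ¹(X) ⊗ Λ¹(X)`. -/
structure Lam2Total (X : Type u) [DiffeologicalSpace X] : Type u where
  /-- The base point. -/
  base : X
  /-- The element of the fibre. -/
  vec : Lam2 base

/-- The tensor product diffeology: plots are locally finite sums of tensor products of plots of
`Λ¹(X)` over a common plot of the base; locally each of the latter is the family of values of a
plot of `Ω¹(X)`. -/
instance lam2Diffeology (X : Type u) [DiffeologicalSpace X] :
    DiffeologicalSpace (Lam2Total X) :=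
  generated (fun n => {q | ∃ (b : E n → X) (k : ℕ) (θ η : Fin k → E n → Omega1 X),
      IsPlot b ∧ (∀ i, IsPlot (θ i)) ∧ (∀ i, IsPlot (η i)) ∧
      q = fun r => ⟨b r, ∑ i, val (b r) (θ i r) ⊗ₜ[ℝ] val (b r) (η i r)⟩})
    (by
      rintro n ⟨x, v⟩
      obtain ⟨k, θ, η, rfl⟩ : ∃ (k : ℕ) (θ η : Fin k → Omega1 X),
          v = ∑ i, val x (θ i) ⊗ₜ[ℝ] val x (η i) := by
        induction v using TensorProduct.induction_on with
        | zero => exact ⟨0, Fin.elim0, Fin.elim0, by simp⟩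
        | tmul a b =>
          obtain ⟨α, rfl⟩ := (vanishing x).mkQ_surjective a
          obtain ⟨β, rfl⟩ := (vanishing x).mkQ_surjective b
          exact ⟨1, fun _ => α, fun _ => β, by simp⟩
        | add a b ha hb =>
          obtain ⟨k, θ, η, rfl⟩ := ha
          obtain ⟨k', θ', η', rfl⟩ := hb
          exact ⟨k + k', Fin.append θ θ', Fin.append η η', by simp [Fin.sum_univ_add]⟩
      exact ⟨fun _ => x, k, fun i _ => θ i, fun i _ => η i, isPlot_const,
        fun _ => isPlot_const, fun _ => isPlot_const, rfl⟩)
    (by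
      rintro n m _ f ⟨b, k, θ, η, hb, hθ, hη, rfl⟩ hf
      exact ⟨b ∘ f, k, fun i => θ i ∘ f, fun i => η i ∘ f, isPlot_reparam hb hf,
        fun i => isPlot_reparam (hθ i) hf, fun i => isPlot_reparam (hη i) hf, rfl⟩)

theorem isPlot_lam2_iff {X : Type u} [DiffeologicalSpace X] {n : ℕ} {b : E n → X}
    {v : ∀ r, Lam2 (b r)} : IsPlot (fun r => (⟨b r, v r⟩ : Lam2Total X)) ↔ IsPlot b ∧
      ∀ r₀, ∃ (k : ℕ) (θ η : Fin k → E n → Omega1 X),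
        (∀ i, IsPlot (θ i)) ∧ (∀ i, IsPlot (η i)) ∧
        ∀ᶠ r in 𝓝 r₀, v r = ∑ i, val (b r) (θ i r) ⊗ₜ[ℝ] val (b r) (η i r) := by
  constructor
  · intro h
    refine ⟨isPlot_of_locally fun r₀ => ?_, fun r₀ => ?_⟩
    · obtain ⟨_, ⟨p, k, θ, η, hp, hθ, hη, rfl⟩, hq⟩ := h r₀
      exact ⟨p, hp, hq.mono fun r hr => congrArg Lam2Total.base hr⟩
    · obtain ⟨_, ⟨p, k, θ, η, hp, hθ, hη, rfl⟩, hq⟩ := h r₀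
      refine ⟨k, θ, η, hθ, hη, hq.mono fun r hr => ?_⟩
      obtain ⟨h1, h2⟩ := Lam2Total.mk.inj hr
      rw [← h1] at h2
      exact eq_of_heq h2
  · rintro ⟨hb, h⟩ r₀
    obtain ⟨k, θ, η, hθ, hη, hr⟩ := h r₀
    refine ⟨_, ⟨b, k, θ, η, hb, hθ, hη, rfl⟩, hr.mono fun r hr => ?_⟩
    simp only [hr]

/-! ### Smooth sections -/

theorem smoothAlong_add {X : Type u} [DiffeologicalSpace X] {n : ℕ} {b : E n → X}
    {v w : ∀ r, Lam (b r)} (hv : SmoothAlong b v) (hw : SmoothAlong b w) :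
    SmoothAlong b (fun r => v r + w r) := by
  rw [smoothAlong_iff] at *
  refine ⟨hv.1, fun r₀ => ?_⟩
  obtain ⟨θ, hθ, h⟩ := hv.2 r₀
  obtain ⟨η, hη, h'⟩ := hw.2 r₀
  refine ⟨fun r => θ r + η r, fun k p => (hθ k p).add (hη k p), ?_⟩
  filter_upwards [h, h'] with r hr hr'
  rw [hr, hr', map_add]

theorem smoothAlong_smul {X : Type u} [DiffeologicalSpace X] {n : ℕ} {b : E n → X}
    {v : ∀ r, Lam (b r)} {c : E n → ℝ} (hc : ContDiff ℝ ∞ c) (hv : SmoothAlong b v) :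
    SmoothAlong b (fun r => c r • v r) := by
  rw [smoothAlong_iff] at *
  refine ⟨hv.1, fun r₀ => ?_⟩
  obtain ⟨θ, hθ, h⟩ := hv.2 r₀
  refine ⟨fun r => c r • θ r, fun k p => (hc.comp contDiff_fst).smul (hθ k p), ?_⟩
  filter_upwards [h] with r hr
  rw [hr, map_smul]

theorem smoothAlong_val {X : Type u} [DiffeologicalSpace X] {n : ℕ} {b : E n → X} (hb : IsPlot b)
    (α : Omega1 X) : SmoothAlong b (fun r => val (b r) α) :=
  smoothAlong_iff.mpr ⟨hb, fun _ => ⟨fun _ => α, isPlot_const, Filter.Eventually.of_forall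
    fun _ => rfl⟩⟩

theorem smoothAlong_lamMap {A : Type u} {B : Type v} [DiffeologicalSpace A]
    [DiffeologicalSpace B] (h : A → B) (hh : DSmooth h) {n : ℕ} {b : E n → A} (hb : IsPlot b)
    {w : ∀ r, Lam (h (b r))} (hw : SmoothAlong (fun r => h (b r)) w) :
    SmoothAlong b (fun r => lamMap h hh (b r) _ rfl (w r)) := by
  rw [smoothAlong_iff] at *
  refine ⟨hb, fun r₀ => ?_⟩
  obtain ⟨θ, hθ, h'⟩ := hw.2 r₀
  refine ⟨fun r => pullback h hh (θ r), fun k p => hθ k ⟨h ∘ p.1, hh k p.1 p.2⟩, ?_⟩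
  filter_upwards [h'] with r hr
  rw [hr]
  rfl

/-- The space `C^∞(X, Λ¹(X))` of smooth sections. -/
def Sections (X : Type u) [DiffeologicalSpace X] : Submodule ℝ (∀ x : X, Lam x) where
  carrier := {s | DSmooth fun x => (⟨x, s x⟩ : LamTotal X)}
  add_mem' := fun hs ht n p hp => smoothAlong_add (hs n p hp) (ht n p hp)
  zero_mem' := fun n p hp => by
    have := smoothAlong_val hp 0
    simp only [map_zero] at this
    exact this
  smul_mem' := fun c s hs n p hp => smoothAlong_smul (contDiff_const (c := c)) (hs n p hp)

/-- The space `C^∞(X, Λ¹(X) ⊗ Λ¹(X))` of smooth sections. -/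
def Sections2 (X : Type u) [DiffeologicalSpace X] : Submodule ℝ (∀ x : X, Lam2 x) where
  carrier := {s | DSmooth fun x => (⟨x, s x⟩ : Lam2Total X)}
  add_mem' := fun {s t} hs ht n p hp => by
    refine isPlot_lam2_iff.mpr ⟨hp, fun r₀ => ?_⟩
    obtain ⟨k, θ, η, hθ, hη, h⟩ := (isPlot_lam2_iff.mp (hs n p hp)).2 r₀
    obtain ⟨k', θ', η', hθ', hη', h'⟩ := (isPlot_lam2_iff.mp (ht n p hp)).2 r₀
    refine ⟨k + k', Fin.append θ θ', Fin.append η η', ?_, ?_, ?_⟩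
    · intro i
      refine Fin.addCases (fun i => ?_) (fun i => ?_) i
      · simpa using hθ i
      · simpa using hθ' i
    · intro i
      refine Fin.addCases (fun i => ?_) (fun i => ?_) i
      · simpa using hη i
      · simpa using hη' i
    · filter_upwards [h, h'] with r hr hr'
      simp only [Pi.add_apply, hr, hr', Fin.sum_univ_add, Fin.append_left, Fin.append_right]
  zero_mem' := fun n p hp => isPlot_lam2_iff.mpr ⟨hp, fun _ =>
    ⟨0, Fin.elim0, Fin.elim0, fun i => i.elim0, fun i => i.elim0,
      Filter.Eventually.of_forall fun _ => by simp⟩⟩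
  smul_mem' := fun c s hs n p hp => by
    refine isPlot_lam2_iff.mpr ⟨hp, fun r₀ => ?_⟩
    obtain ⟨k, θ, η, hθ, hη, h⟩ := (isPlot_lam2_iff.mp (hs n p hp)).2 r₀
    refine ⟨k, fun i r => c • θ i r, η, fun i l q => (contDiff_const (c := c)).smul (hθ i l q), hη, ?_⟩
    filter_upwards [h] with r hr
    simp only [Pi.smul_apply, hr, Finset.smul_sum, TensorProduct.smul_tmul', map_smul]

/-- The functional diffeology on `C^∞(X, Λ¹(X))`. -/
instance sectionsDiffeology (X : Type u) [DiffeologicalSpace X] :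
    DiffeologicalSpace (Sections X) where
  plots m := {q | ∀ (k : ℕ) (a : E k → E m) (p : E k → X), ContDiff ℝ ∞ a → IsPlot p →
    IsPlot fun r => (⟨p r, (q (a r)).1 (p r)⟩ : LamTotal X)}
  constant_plots s := fun _ _ p _ hp => s.2 _ p hp
  plot_reparam := fun hq hf _ a p ha hp => hq _ _ p (hf.comp ha) hp
  locality := by
    intro m q hq k a p ha hp
    refine isPlot_of_locally fun r₀ => ?_
    obtain ⟨U, hU, hxU, h⟩ := hq (a r₀)
    obtain ⟨φ, hφ, hφU, hφx⟩ := exists_squash hU hxU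
    refine ⟨_, h hφU hφ k a p ha hp, ?_⟩
    filter_upwards [ha.continuous.continuousAt.eventually hφx] with r hr
    simp only [Function.comp_apply, hr]

/-- The functional diffeology on `C^∞(X, Λ¹(X) ⊗ Λ¹(X))`. -/
instance sections2Diffeology (X : Type u) [DiffeologicalSpace X] :
    DiffeologicalSpace (Sections2 X) where
  plots m := {q | ∀ (k : ℕ) (a : E k → E m) (p : E k → X), ContDiff ℝ ∞ a → IsPlot p →
    IsPlot fun r => (⟨p r, (q (a r)).1 (p r)⟩ : Lam2Total X)}
  constant_plots s := fun _ _ p _ hp => s.2 _ p hp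
  plot_reparam := fun hq hf _ a p ha hp => hq _ _ p (hf.comp ha) hp
  locality := by
    intro m q hq k a p ha hp
    refine isPlot_of_locally fun r₀ => ?_
    obtain ⟨U, hU, hxU, h⟩ := hq (a r₀)
    obtain ⟨φ, hφ, hφU, hφx⟩ := exists_squash hU hxU
    refine ⟨_, h hφU hφ k a p ha hp, ?_⟩
    filter_upwards [ha.continuous.continuousAt.eventually hφx] with r hr
    simp only [Function.comp_apply, hr]

/-- The product of a smooth function and a smooth section. -/
def smulSection {X : Type u} [DiffeologicalSpace X] (h : smoothFunctions X) (s : Sections X) :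
    Sections X :=
  ⟨fun x => h.1 x • s.1 x, fun n p hp =>
    smoothAlong_smul (smoothFunctions_comp h hp) (s.2 n p hp)⟩

/-- The differential of a smooth function, as a smooth section of `Λ¹(X)`. -/
def dSection {X : Type u} [DiffeologicalSpace X] (h : smoothFunctions X) : Sections X :=
  ⟨fun x => val x (differential h), fun _ _ hp => smoothAlong_val hp _⟩

/-! ### Pseudo-metrics and connections on `Λ¹(X)` -/

/-- A pseudo-metric on `Λ¹(X)`: the fibres are finite-dimensional, and `form` is a smooth family of
symmetric positive semidefinite bilinear forms on the fibres, with the least possible degeneracy: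
the nullity at `x` is the dimension of the fibre minus that of its diffeological dual. -/
structure PseudoMetric (X : Type u) [DiffeologicalSpace X] where
  /-- The bilinear form on each fibre. -/
  form : ∀ x : X, Lam x →ₗ[ℝ] Lam x →ₗ[ℝ] ℝ
  finite : ∀ x : X, Module.Finite ℝ (Lam x)
  symm : ∀ (x : X) (v w : Lam x), form x v w = form x w v
  nonneg : ∀ (x : X) (v : Lam x), 0 ≤ form x v v
  nullity : ∀ x : X, Module.finrank ℝ (LinearMap.ker (form x)) +
    Module.finrank ℝ (smoothDual x) = Module.finrank ℝ (Lam x)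
  smooth : ∀ (n : ℕ) (b : E n → X) (v w : ∀ r, Lam (b r)), SmoothAlong b v → SmoothAlong b w →
    ContDiff ℝ ∞ fun r => form (b r) (v r) (w r)

/-- The smooth function `g(s, t)`. -/
def PseudoMetric.pair {X : Type u} [DiffeologicalSpace X] (g : PseudoMetric X)
    (s t : Sections X) : smoothFunctions X :=
  ⟨fun x => g.form x (s.1 x) (t.1 x), fun n p hp => isPlot_iff_contDiff.mpr
    (g.smooth n p (fun r => s.1 (p r)) (fun r => t.1 (p r)) (s.2 n p hp) (t.2 n p hp))⟩

/-- The action of a section `t` of `Λ¹(X)`, identified through the pairing map of `g` with a section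
of the dual pseudo-bundle, on a smooth function: `t(h) = g(t, dh)`. -/
def PseudoMetric.action {X : Type u} [DiffeologicalSpace X] (g : PseudoMetric X)
    (t : Sections X) (h : smoothFunctions X) : smoothFunctions X :=
  g.pair t (dSection h)

/-- A diffeological connection on `Λ¹(X)`: a smooth linear operator
`C^∞(X, Λ¹(X)) → C^∞(X, Λ¹(X) ⊗ Λ¹(X))` satisfying the Leibniz rule. -/
structure Connection (X : Type u) [DiffeologicalSpace X] where
  /-- The underlying linear operator. -/
  op : Sections X →ₗ[ℝ] Sections2 X
  smooth : DSmooth fun s => op s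
  leibniz : ∀ (h : smoothFunctions X) (s : Sections X) (x : X),
    (op (smulSection h s)).1 x = (dSection h).1 x ⊗ₜ[ℝ] s.1 x + h.1 x • (op s).1 x

/-- Contraction of the first factor with `g(v, ·)`. -/
def PseudoMetric.contractLeft {X : Type u} [DiffeologicalSpace X] (g : PseudoMetric X) {x : X}
    (v : Lam x) : Lam2 x →ₗ[ℝ] Lam x :=
  (TensorProduct.lid ℝ (Lam x)).toLinearMap ∘ₗ (g.form x v).rTensor (Lam x)

/-- Contraction of the second factor with `g(v, ·)`: on decomposable elements
`θ ⊗ w ↦ g(v, w) θ`. -/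
def PseudoMetric.contractRight {X : Type u} [DiffeologicalSpace X] (g : PseudoMetric X) {x : X}
    (v : Lam x) : Lam2 x →ₗ[ℝ] Lam x :=
  (TensorProduct.rid ℝ (Lam x)).toLinearMap ∘ₗ (g.form x v).lTensor (Lam x)

/-- The value at `x` of the covariant derivative `∇_t s` along a section `t` of `Λ¹(X)`. -/
def Connection.cov {X : Type u} [DiffeologicalSpace X] (D : Connection X) (g : PseudoMetric X)
    (t s : Sections X) (x : X) : Lam x :=
  g.contractLeft (t.1 x) ((D.op s).1 x)

/-- Compatibility of a connection with a pseudo-metric: `d(g(s, t)) = g(∇s, t) + g(s, ∇t)`. -/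
def Connection.IsMetric {X : Type u} [DiffeologicalSpace X] (D : Connection X)
    (g : PseudoMetric X) : Prop :=
  ∀ (s t : Sections X) (x : X), (dSection (g.pair s t)).1 x =
    g.contractRight (t.1 x) ((D.op s).1 x) + g.contractRight (s.1 x) ((D.op t).1 x)

/-- The family `b` of elements of the fibres is the Lie bracket `[s, t]` with respect to `g`, that
is, it acts on smooth functions by `[s, t](h) = s(t(h)) - t(s(h))`. -/
def IsLieBracket {X : Type u} [DiffeologicalSpace X] (g : PseudoMetric X) (s t : Sections X)
    (b : ∀ x : X, Lam x) : Prop :=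
  ∀ (h : smoothFunctions X) (x : X), g.form x (b x) ((dSection h).1 x) =
    (g.action s (g.action t h)).1 x - (g.action t (g.action s h)).1 x

/-- The connection is symmetric: `∇_s t - ∇_t s = [s, t]`. -/
def Connection.IsSymmetric {X : Type u} [DiffeologicalSpace X] (D : Connection X)
    (g : PseudoMetric X) : Prop :=
  ∀ s t : Sections X, IsLieBracket g s t fun x => D.cov g s t x - D.cov g t s x

/-- Levi-Civita connections on `(Λ¹(X), g)`. -/
structure Connection.IsLeviCivita {X : Type u} [DiffeologicalSpace X] (D : Connection X)
    (g : PseudoMetric X) : Prop where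
  metric : D.IsMetric g
  symmetric : D.IsSymmetric g

/-! ### Gluing -/

section Gluing

variable {X₁ : Type u} {X₂ : Type v} [DiffeologicalSpace X₁] [DiffeologicalSpace X₂] {Y : Set X₁}

/-- `f` is a diffeomorphism of its domain `Y` onto its image, both with the subset diffeology. -/
structure IsDiffeoOntoImage (f : Y → X₂) : Prop where
  injective : Function.Injective f
  smooth : DSmooth f
  smooth_inv : DSmooth (Equiv.ofInjective f injective).symm

/-- The diffeology `𝒟₁^Ω` on `Ω¹(Y)`: the pushforward of that of `Ω¹(X₁)` by restriction
to `Y`. -/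
@[reducible]
def restrictionDiffeology₁ (Y : Set X₁) : DiffeologicalSpace (Omega1 Y) :=
  pushforward (pullback (Subtype.val : Y → X₁) (dSmooth_val Y))

/-- The diffeology `𝒟₂^Ω` on `Ω¹(Y)`: the pushforward of that of `Ω¹(X₂)` by pullback along
`f`. -/
@[reducible]
def restrictionDiffeology₂ {f : Y → X₂} (hf : IsDiffeoOntoImage f) :
    DiffeologicalSpace (Omega1 Y) :=
  pushforward (pullback f hf.smooth)

/-- The relation on the disjoint union identifying `y ∈ Y` with `f y`. -/
inductive GlueRel (f : Y → X₂) : X₁ ⊕ X₂ → X₁ ⊕ X₂ → Prop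
  | glue (y : Y) : GlueRel f (Sum.inl y.1) (Sum.inr (f y))

/-- The glued space `X₁ ∪_f X₂`. -/
def Glue (f : Y → X₂) : Type (max u v) := Quot (GlueRel f)

/-- The quotient diffeology on the glued space. -/
instance glueDiffeology (f : Y → X₂) : DiffeologicalSpace (Glue f) :=
  pushforward (Quot.mk (GlueRel f))

/-- The natural map `X₁ → X₁ ∪_f X₂`. -/
def glue₁ (f : Y → X₂) (x : X₁) : Glue f := Quot.mk _ (Sum.inl x)

/-- The natural inclusion `X₂ → X₁ ∪_f X₂`. -/
def glue₂ (f : Y → X₂) (x : X₂) : Glue f := Quot.mk _ (Sum.inr x)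

theorem glue₁_eq (f : Y → X₂) (y : Y) : glue₁ f y.1 = glue₂ f (f y) :=
  Quot.sound (GlueRel.glue y)

theorem dSmooth_glue₁ (f : Y → X₂) : DSmooth (glue₁ f) := fun n p hp =>
  dSmooth_pushforward (Quot.mk (GlueRel f)) n (Sum.inl ∘ p)
    fun _ => ⟨_, Or.inl ⟨p, hp, rfl⟩, Filter.EventuallyEq.rfl⟩

theorem dSmooth_glue₂ (f : Y → X₂) : DSmooth (glue₂ f) := fun n p hp =>
  dSmooth_pushforward (Quot.mk (GlueRel f)) n (Sum.inr ∘ p)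
    fun _ => ⟨_, Or.inr ⟨p, hp, rfl⟩, Filter.EventuallyEq.rfl⟩

/-- The map `ρ̃₁ : Λ¹(X₁ ∪_f X₂) → Λ¹(X₁)` from the fibre over `z` to the fibre over `x`, where
`z` is the image of `x ∈ X₁`. -/
def rho₁ (f : Y → X₂) (x : X₁) (z : Glue f) (hz : glue₁ f x = z) : Lam z →ₗ[ℝ] Lam x :=
  lamMap (glue₁ f) (dSmooth_glue₁ f) x z hz

/-- The map `ρ̃₂ : Λ¹(X₁ ∪_f X₂) → Λ¹(X₂)` from the fibre over `z` to the fibre over `x`, where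
`z` is the image of `x ∈ X₂`. -/
def rho₂ (f : Y → X₂) (x : X₂) (z : Glue f) (hz : glue₂ f x = z) : Lam z →ₗ[ℝ] Lam x :=
  lamMap (glue₂ f) (dSmooth_glue₂ f) x z hz

/-- The map `i_Λ^* : Λ¹_y(X₁) → Λ¹_y(Y)` induced by restriction of forms. -/
def res₁ (y : Y) : Lam (y : X₁) →ₗ[ℝ] Lam y :=
  lamMap Subtype.val (dSmooth_val Y) y y rfl

/-- The map `f_Λ^* j_Λ^* : Λ¹_{f(y)}(X₂) → Λ¹_y(Y)` induced by pullback along `f`. -/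
def res₂ {f : Y → X₂} (hf : IsDiffeoOntoImage f) (y : Y) : Lam (f y) →ₗ[ℝ] Lam y :=
  lamMap f hf.smooth y (f y) rfl

/-- Compatibility of elements of `Λ¹_y(X₁)` and `Λ¹_{f(y)}(X₂)`. -/
def CompatibleElements {f : Y → X₂} (hf : IsDiffeoOntoImage f) (y : Y) (α₁ : Lam (y : X₁))
    (α₂ : Lam (f y)) : Prop :=
  res₁ y α₁ = res₂ hf y α₂

/-- Compatibility of pseudo-metrics: they agree on pairs of compatible elements. -/
def CompatibleMetrics {f : Y → X₂} (hf : IsDiffeoOntoImage f) (g₁ : PseudoMetric X₁)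
    (g₂ : PseudoMetric X₂) : Prop :=
  ∀ (y : Y) (α₁ β₁ : Lam (y : X₁)) (α₂ β₂ : Lam (f y)), CompatibleElements hf y α₁ α₂ →
    CompatibleElements hf y β₁ β₂ → g₁.form y α₁ β₁ = g₂.form (f y) α₂ β₂

/-- Compatibility of sections: their values over each `y ∈ Y` are compatible. -/
def CompatibleSections {f : Y → X₂} (hf : IsDiffeoOntoImage f) (s₁ : Sections X₁)
    (s₂ : Sections X₂) : Prop :=
  ∀ y : Y, CompatibleElements hf y (s₁.1 y) (s₂.1 (f y))

/-- Compatibility of connections: on compatible sections their values over each `y ∈ Y` have the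
same image in `Λ¹_y(Y) ⊗ Λ¹_y(Y)`. -/
def CompatibleConnections {f : Y → X₂} (hf : IsDiffeoOntoImage f) (D₁ : Connection X₁)
    (D₂ : Connection X₂) : Prop :=
  ∀ (s₁ : Sections X₁) (s₂ : Sections X₂), CompatibleSections hf s₁ s₂ → ∀ y : Y,
    TensorProduct.map (res₁ y) (res₁ y) ((D₁.op s₁).1 y) =
      TensorProduct.map (res₂ hf y) (res₂ hf y) ((D₂.op s₂).1 (f y))

/-- `g` is the pseudo-metric on `Λ¹(X₁ ∪_f X₂)` induced by `g₁` and `g₂`: it is the pullback of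
`g₁` by `ρ̃₁` away from the image of `X₂`, the pullback of `g₂` by `ρ̃₂` away from the image of
`X₁`, and the half-sum of the two pullbacks over the common part. -/
structure IsInducedMetric (f : Y → X₂) (g₁ : PseudoMetric X₁) (g₂ : PseudoMetric X₂)
    (g : PseudoMetric (Glue f)) : Prop where
  left : ∀ x : X₁, x ∉ Y → ∀ v w : Lam (glue₁ f x),
    g.form (glue₁ f x) v w = g₁.form x (rho₁ f x _ rfl v) (rho₁ f x _ rfl w)
  right : ∀ x : X₂, x ∉ Set.range f → ∀ v w : Lam (glue₂ f x),
    g.form (glue₂ f x) v w = g₂.form x (rho₂ f x _ rfl v) (rho₂ f x _ rfl w)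
  common : ∀ (y : Y) (v w : Lam (glue₂ f (f y))),
    g.form (glue₂ f (f y)) v w =
      (1 / 2 : ℝ) * (g₁.form y (rho₁ f y _ (glue₁_eq f y) v) (rho₁ f y _ (glue₁_eq f y) w) +
        g₂.form (f y) (rho₂ f (f y) _ rfl v) (rho₂ f (f y) _ rfl w))

/-- The section `s₁ = ρ̃₁ ∘ s ∘ ĩ₁` of `Λ¹(X₁)`. -/
def section₁ (f : Y → X₂) (s : Sections (Glue f)) : Sections X₁ :=
  ⟨fun x => rho₁ f x _ rfl (s.1 (glue₁ f x)), fun n p hp =>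
    smoothAlong_lamMap (glue₁ f) (dSmooth_glue₁ f) hp (w := fun r => s.1 (glue₁ f (p r)))
      (s.2 n _ (dSmooth_glue₁ f n p hp))⟩

/-- The section `s₂ = ρ̃₂ ∘ s ∘ i₂` of `Λ¹(X₂)`. -/
def section₂ (f : Y → X₂) (s : Sections (Glue f)) : Sections X₂ :=
  ⟨fun x => rho₂ f x _ rfl (s.1 (glue₂ f x)), fun n p hp =>
    smoothAlong_lamMap (glue₂ f) (dSmooth_glue₂ f) hp (w := fun r => s.1 (glue₂ f (p r)))
      (s.2 n _ (dSmooth_glue₂ f n p hp))⟩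

/-- `D` is the operator `∇_∪` on sections of `Λ¹(X₁ ∪_f X₂)` induced by two connections: the value
of `D s` is carried by `ρ̃₁ ⊗ ρ̃₁` to that of `∇¹ s₁` away from the image of `X₂`, by `ρ̃₂ ⊗ ρ̃₂`
to that of `∇² s₂` away from the image of `X₁`, and to both of them over the common part. -/
structure IsInducedOperator (f : Y → X₂) (D₁ : Connection X₁) (D₂ : Connection X₂)
    (D : Sections (Glue f) → ∀ z : Glue f, Lam2 z) : Prop where
  left : ∀ (s : Sections (Glue f)) (x : X₁), x ∉ Y →
    TensorProduct.map (rho₁ f x _ rfl) (rho₁ f x _ rfl) (D s (glue₁ f x)) =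
      (D₁.op (section₁ f s)).1 x
  right : ∀ (s : Sections (Glue f)) (x : X₂), x ∉ Set.range f →
    TensorProduct.map (rho₂ f x _ rfl) (rho₂ f x _ rfl) (D s (glue₂ f x)) =
      (D₂.op (section₂ f s)).1 x
  common₁ : ∀ (s : Sections (Glue f)) (y : Y),
    TensorProduct.map (rho₁ f y _ (glue₁_eq f y)) (rho₁ f y _ (glue₁_eq f y))
      (D s (glue₂ f (f y))) = (D₁.op (section₁ f s)).1 y
  common₂ : ∀ (s : Sections (Glue f)) (y : Y),
    TensorProduct.map (rho₂ f (f y) _ rfl) (rho₂ f (f y) _ rfl) (D s (glue₂ f (f y))) =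
      (D₂.op (section₂ f s)).1 (f y)

end Gluing

end DiffGlue

end

/-!
The evaluations of covectors at `x` along plots centred at `x` are smooth functionals on
`Λ¹_x(X)`, and they separate points because a class is zero exactly when they all vanish on it.
Hence the diffeological dual of a finite-dimensional fibre is its whole dual
(`smoothDual_eq_top`), and every pseudo-metric is nondegenerate.

The equality of the two diffeologies on `Ω¹(Y)` says that, locally, a smooth family of forms on one
piece has a partner on the other piece with the same restriction to `Y` (`exists_plot_lift`). In
particular every element of `Λ¹_y(X₁)` has a compatible partner in `Λ¹_{f(y)}(X₂)`, and conversely.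
If `v` in `Λ¹_y(X₁)` restricts to zero over `Y`, then `v` is compatible with `0`, so that
`g₁(v, w) = g₂(0, w') = 0` for all `w`, and `v = 0`. Thus restriction to `Y` is injective on the
fibres of both pieces (`res₁_injective`, `res₂_injective`).

Forms on the glued space are the pairs of forms on the pieces with equal restrictions to `Y`
(`exists_glue_form`). Together with the above, `ρ̃₁` and `ρ̃₂` are isomorphisms on all fibres, and
plots of forms on each piece extend locally to the glued space (`inducesLamIso_glue₁`,
`inducesLamIso_glue₂`). Over the common part the pullbacks of `g₁` and `g₂` then agree, and so do the
preimages of the values of the two connections. The metric and the connection on the glued space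
are therefore the ones that restrict to the given data on each piece, and every pointwise identity
for them can be checked after applying `ρ̃₁` or `ρ̃₂`.
-/

namespace DiffGlue

universe u v

/-! ### Locality of forms and nondegeneracy of pseudo-metrics -/

section Forms

variable {X : Type u} [DiffeologicalSpace X]

/-- The value of a form on a plot at a point depends only on the germ of the plot there. -/
theorem omega_congr (α : Omega1 X) {n : ℕ} {p q : Plot X n} {r : E n}
    (h : p.1 =ᶠ[𝓝 r] q.1) : α.1 n p r = α.1 n q r := by
  obtain ⟨U, hU, hUo, hrU⟩ := eventually_nhds_iff.mp h
  obtain ⟨φ, hφ, hφU, hφr⟩ := exists_squash hUo hrU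
  have key : ∀ p : Plot X n, α.1 n ⟨p.1 ∘ φ, isPlot_reparam p.2 hφ⟩ r = α.1 n p r := by
    intro p
    have hd : fderiv ℝ φ r = ContinuousLinearMap.id ℝ (E n) := by
      rw [Filter.EventuallyEq.fderiv_eq (f := fun y => y) hφr, fderiv_fun_id]
    rw [α.2.2 n n p φ hφ r, hφr.self_of_nhds, hd, ContinuousLinearMap.comp_id]
  have hpq : p.1 ∘ φ = q.1 ∘ φ := funext fun y => hU (φ y) (hφU y)
  rw [← key p, ← key q]
  simp only [hpq]

theorem omega_ext {α β : Omega1 X} (h : ∀ n p r, α.1 n p r = β.1 n p r) : α = β :=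
  Subtype.ext (funext fun n => funext fun p => funext fun r => h n p r)

theorem val_eq_zero_iff {x : X} {α : Omega1 X} :
    val x α = 0 ↔ ∀ (n : ℕ) (p : Plot X n), p.1 0 = x → α.1 n p 0 = 0 :=
  Submodule.Quotient.mk_eq_zero _

/-- The evaluation of covectors at `x` on the velocity `e` of a plot centred at `x`. -/
def evalPlot {n : ℕ} (p : Plot X n) (e : E n) : Module.Dual ℝ (Lam (p.1 0)) :=
  (vanishing (p.1 0)).liftQ
    { toFun := fun α => α.1 n p 0 e
      map_add' := fun _ _ => rfl
      map_smul' := fun _ _ => rfl }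
    fun α hα => by
      change α.1 n p 0 e = 0
      rw [hα n p rfl]
      rfl

theorem evalPlot_mem_smoothDual {n : ℕ} (p : Plot X n) (e : E n) :
    evalPlot p e ∈ smoothDual (p.1 0) := by
  intro m w hw
  refine isPlot_iff_contDiff.mpr (contDiff_iff_contDiffAt.mpr fun r₀ => ?_)
  obtain ⟨θ, hθ, h⟩ := (smoothAlong_iff.mp hw).2 r₀
  have hs : ContDiff ℝ ∞ fun r => (θ r).1 n p 0 e :=
    ((hθ n p).comp (contDiff_id.prodMk contDiff_const)).clm_apply contDiff_const
  refine hs.contDiffAt.congr_of_eventuallyEq ?_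
  filter_upwards [h] with r hr
  exact congrArg (evalPlot p e) hr

/-- Evaluations on plots are smooth and separate the points of a fibre by the very definition of
`vanishing`, so every functional on a finite-dimensional fibre is smooth. -/
theorem smoothDual_eq_top (x : X) [Module.Finite ℝ (Lam x)] : smoothDual x = ⊤ := by
  have h : (smoothDual x).dualCoannihilator = ⊥ := by
    refine (Submodule.eq_bot_iff _).mpr fun v hv => ?_
    obtain ⟨α, rfl⟩ := (vanishing x).mkQ_surjective v
    refine val_eq_zero_iff.mpr fun n p hp => ?_
    subst hp
    ext e
    exact (Submodule.mem_dualCoannihilator _).mp hv _ (evalPlot_mem_smoothDual p e)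
  rw [← Subspace.dualCoannihilator_dualAnnihilator_eq (W := smoothDual x), h,
    Submodule.dualAnnihilator_bot]

theorem PseudoMetric.eq_zero_of_forall (g : PseudoMetric X) {x : X} {v : Lam x}
    (h : ∀ w, g.form x v w = 0) : v = 0 := by
  have := g.finite x
  have hn := g.nullity x
  rw [smoothDual_eq_top, finrank_top, Subspace.dual_finrank_eq] at hn
  have hk : LinearMap.ker (g.form x) = ⊥ := Submodule.finrank_eq_zero.mp (by omega)
  exact (Submodule.eq_bot_iff _).mp hk v (LinearMap.ext h)

end Forms

/-! ### Pulling back functions and sections -/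

section Pullback

variable {A : Type u} {B : Type v} [DiffeologicalSpace A] [DiffeologicalSpace B] {h : A → B}

theorem isPlot_pullback (hh : DSmooth h) {m : ℕ} {θ : E m → Omega1 B} (hθ : IsPlot θ) :
    IsPlot fun r => pullback h hh (θ r) :=
  fun n p => hθ n ⟨h ∘ p.1, hh n p.1 p.2⟩

/-- The composition of a smooth function with a smooth map. -/
def pullFunction (hh : DSmooth h) (k : smoothFunctions B) : smoothFunctions A :=
  ⟨k.1 ∘ h, k.2.comp hh⟩

/-- The pullback of a smooth section of `Λ¹` by a smooth map. -/
def pullSection (hh : DSmooth h) (s : Sections B) : Sections A :=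
  ⟨fun a => lamMap h hh a _ rfl (s.1 (h a)), fun n p hp =>
    smoothAlong_lamMap h hh hp (w := fun r => s.1 (h (p r))) (s.2 n _ (hh n p hp))⟩

theorem pullSection_add (hh : DSmooth h) (s t : Sections B) :
    pullSection hh (s + t) = pullSection hh s + pullSection hh t :=
  Subtype.ext (funext fun _ => map_add _ _ _)

theorem pullSection_smul (hh : DSmooth h) (c : ℝ) (s : Sections B) :
    pullSection hh (c • s) = c • pullSection hh s :=
  Subtype.ext (funext fun a => (lamMap h hh a _ rfl).map_smul c (s.1 (h a)))

theorem pullSection_smulSection (hh : DSmooth h) (k : smoothFunctions B) (s : Sections B) :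
    pullSection hh (smulSection k s) = smulSection (pullFunction hh k) (pullSection hh s) :=
  Subtype.ext (funext fun _ => map_smul _ _ _)

theorem dSmooth_pullSection (hh : DSmooth h) : DSmooth fun s => pullSection hh s := by
  intro m q hq k a p ha hp
  exact smoothAlong_lamMap h hh hp (w := fun r => (q (a r)).1 (h (p r)))
    (hq k a _ ha (hh k p hp))

end Pullback

/-! ### Smooth maps identifying the fibres of `Λ¹` -/

/-- The map `h` identifies each fibre of `Λ¹(A)` with the fibre of `Λ¹(B)` over the image point, and
plots of `Ω¹(A)` extend locally to plots of `Ω¹(B)`. Surjectivity on the fibres follows from the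
extension of plots. -/
structure InducesLamIso {A : Type u} {B : Type v} [DiffeologicalSpace A] [DiffeologicalSpace B]
    (h : A → B) (hh : DSmooth h) : Prop where
  lift : ∀ (m : ℕ) (θ : E m → Omega1 A), IsPlot θ → ∀ r₀, ∃ θ' : E m → Omega1 B, IsPlot θ' ∧
    ∀ᶠ r in 𝓝 r₀, pullback h hh (θ' r) = θ r
  injective : ∀ (a : A) (b : B) (hab : h a = b), Function.Injective (lamMap h hh a b hab)

section InducesLamIso

variable {A : Type u} {B : Type v} [DiffeologicalSpace A] [DiffeologicalSpace B] {h : A → B}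
  {hh : DSmooth h}

theorem InducesLamIso.surjective (H : InducesLamIso h hh) (a : A) (b : B) (hab : h a = b) :
    Function.Surjective (lamMap h hh a b hab) := by
  intro v
  obtain ⟨α, rfl⟩ := (vanishing a).mkQ_surjective v
  obtain ⟨θ, -, hθ⟩ := H.lift 0 (fun _ => α) isPlot_const 0
  exact ⟨val b (θ 0), congrArg (val a) hθ.self_of_nhds⟩

theorem InducesLamIso.map_bijective (H : InducesLamIso h hh) (a : A) (b : B) (hab : h a = b) :
    Function.Bijective (TensorProduct.map (lamMap h hh a b hab) (lamMap h hh a b hab)) :=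
  ⟨TensorProduct.map_injective_of_flat_flat _ _ (H.injective a b hab) (H.injective a b hab),
    TensorProduct.map_surjective (H.surjective a b hab) (H.surjective a b hab)⟩

/-- A family of tensors over points of `B` coming from `A` is smooth as soon as the corresponding
family over `A` is. -/
theorem InducesLamIso.isPlot_lam2 (H : InducesLamIso h hh) {n : ℕ} {b : E n → A}
    {w : ∀ r, Lam2 (h (b r))}
    (hw : IsPlot fun r => (⟨b r, TensorProduct.map (lamMap h hh (b r) _ rfl)
      (lamMap h hh (b r) _ rfl) (w r)⟩ : Lam2Total A)) :
    IsPlot fun r => (⟨h (b r), w r⟩ : Lam2Total B) := by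
  obtain ⟨hb, hw⟩ := isPlot_lam2_iff.mp hw
  refine isPlot_lam2_iff.mpr ⟨hh n b hb, fun r₀ => ?_⟩
  obtain ⟨k, θ, η, hθ, hη, hr⟩ := hw r₀
  choose θ' hθ' eθ using fun i => H.lift n (θ i) (hθ i) r₀
  choose η' hη' eη using fun i => H.lift n (η i) (hη i) r₀
  refine ⟨k, θ', η', hθ', hη', ?_⟩
  filter_upwards [hr, Filter.eventually_all.mpr eθ, Filter.eventually_all.mpr eη]
    with r hr hθr hηr
  apply (H.map_bijective (b r) _ rfl).1
  rw [hr, map_sum]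
  refine Finset.sum_congr rfl fun i _ => ?_
  rw [TensorProduct.map_tmul, ← hθr i, ← hηr i]
  rfl

/-! ### Transfer of the metric, symmetry and Leibniz identities -/

section Transfer

variable {g : PseudoMetric B} {gA : PseudoMetric A}

/-- The metric `g` restricts to `gA` along `h`. -/
def PullsBackTo (hh : DSmooth h) (g : PseudoMetric B) (gA : PseudoMetric A) : Prop :=
  ∀ (a : A) (v w : Lam (h a)),
    g.form (h a) v w = gA.form a (lamMap h hh a _ rfl v) (lamMap h hh a _ rfl w)

theorem PullsBackTo.pair (hg : PullsBackTo hh g gA) (s t : Sections B) :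
    pullFunction hh (g.pair s t) = gA.pair (pullSection hh s) (pullSection hh t) :=
  Subtype.ext (funext fun a => hg a (s.1 (h a)) (t.1 (h a)))

theorem PullsBackTo.action (hg : PullsBackTo hh g gA) (s : Sections B) (k : smoothFunctions B) :
    pullFunction hh (g.action s k) = gA.action (pullSection hh s) (pullFunction hh k) :=
  hg.pair s (dSection k)

theorem PullsBackTo.contractLeft (hg : PullsBackTo hh g gA) {a : A} (v : Lam (h a))
    (T : Lam2 (h a)) :
    lamMap h hh a _ rfl (g.contractLeft v T) = gA.contractLeft (lamMap h hh a _ rfl v)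
      (TensorProduct.map (lamMap h hh a _ rfl) (lamMap h hh a _ rfl) T) := by
  induction T using TensorProduct.induction_on with
  | zero => simp
  | tmul x y => simp [PseudoMetric.contractLeft, hg a]
  | add x y hx hy => simp only [map_add, hx, hy]

theorem PullsBackTo.contractRight (hg : PullsBackTo hh g gA) {a : A} (v : Lam (h a))
    (T : Lam2 (h a)) :
    lamMap h hh a _ rfl (g.contractRight v T) = gA.contractRight (lamMap h hh a _ rfl v)
      (TensorProduct.map (lamMap h hh a _ rfl) (lamMap h hh a _ rfl) T) := by
  induction T using TensorProduct.induction_on with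
  | zero => simp
  | tmul x y => simp [PseudoMetric.contractRight, hg a]
  | add x y hx hy => simp only [map_add, hx, hy]

/-- The operator `D` on sections of `Λ¹(B)` is carried to the connection `DA` along `h`. -/
def RestrictsTo (hh : DSmooth h) (D : Sections B → ∀ b : B, Lam2 b) (DA : Connection A) : Prop :=
  ∀ (s : Sections B) (a : A) (b : B) (hab : h a = b),
    TensorProduct.map (lamMap h hh a b hab) (lamMap h hh a b hab) (D s b) =
      (DA.op (pullSection hh s)).1 a

theorem InducesLamIso.leibniz (H : InducesLamIso h hh) {D : Sections B → ∀ b : B, Lam2 b}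
    {DA : Connection A} (hD : RestrictsTo hh D DA) (k : smoothFunctions B) (s : Sections B)
    (a : A) : D (smulSection k s) (h a) =
      (dSection k).1 (h a) ⊗ₜ[ℝ] s.1 (h a) + k.1 (h a) • D s (h a) := by
  apply (H.map_bijective a _ rfl).1
  rw [map_add, map_smul, hD _ a _ rfl, hD _ a _ rfl, pullSection_smulSection, DA.leibniz]
  rfl

theorem InducesLamIso.metric (H : InducesLamIso h hh) (hg : PullsBackTo hh g gA)
    {D : Connection B} {DA : Connection A} (hD : RestrictsTo hh (fun s => (D.op s).1) DA)
    (hDA : DA.IsMetric gA) (s t : Sections B) (a : A) :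
    (dSection (g.pair s t)).1 (h a) =
      g.contractRight (t.1 (h a)) ((D.op s).1 (h a)) +
        g.contractRight (s.1 (h a)) ((D.op t).1 (h a)) := by
  apply H.injective a _ rfl
  rw [map_add, hg.contractRight, hg.contractRight, hD _ a _ rfl, hD _ a _ rfl]
  have := hDA (pullSection hh s) (pullSection hh t) a
  rw [← hg.pair] at this
  exact this

theorem PullsBackTo.symmetric (hg : PullsBackTo hh g gA) {D : Connection B} {DA : Connection A}
    (hD : RestrictsTo hh (fun s => (D.op s).1) DA) (hDA : DA.IsSymmetric gA) (s t : Sections B)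
    (k : smoothFunctions B) (a : A) :
    g.form (h a) (D.cov g s t (h a) - D.cov g t s (h a)) ((dSection k).1 (h a)) =
      (g.action s (g.action t k)).1 (h a) - (g.action t (g.action s k)).1 (h a) := by
  have := hDA (pullSection hh s) (pullSection hh t) (pullFunction hh k) a
  simp only [← hg.action] at this
  rw [hg a, map_sub]
  simp only [Connection.cov, hg.contractLeft] at this ⊢
  rw [hD _ a _ rfl, hD _ a _ rfl]
  exact this

end Transfer

end InducesLamIso

/-! ### Plots of a pushforward of forms -/

section Pushforward

variable {V : Type u} {W : Type v} {Z : Type*} [DiffeologicalSpace V] [DiffeologicalSpace W]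
  [DiffeologicalSpace Z]

/-- Linear maps into `Ω¹(Z)` with the same pushforward diffeology have the same image. Constant maps
are plots of every diffeology, so the constant plot at `F α` carries no information; the image of
the line `t ↦ t α` does. -/
theorem exists_pullback_eq {F : Omega1 V →ₗ[ℝ] Omega1 Z} {F' : Omega1 W →ₗ[ℝ] Omega1 Z}
    (hFF' : pushforward F = pushforward F') (α : Omega1 V) : ∃ β, F' β = F α := by
  let c : ℝ → E 1 := fun t => EuclideanSpace.single 0 t
  have hc : Continuous c := by
    have : c = fun t => t • EuclideanSpace.single (0 : Fin 1) (1 : ℝ) := by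
      funext t
      ext i
      simp [c, Subsingleton.elim i 0]
    rw [this]
    fun_prop
  have hcoord : ContDiff ℝ ∞ fun t : E 1 => t 0 := contDiff_piLp_apply (p := 2)
  have hline : IsPlot fun t : E 1 => t 0 • α := fun n p =>
    (hcoord.comp contDiff_fst).smul ((α.2.1 n p).comp contDiff_snd)
  have hplot := @dSmooth_pushforward _ _ _ F 1 _ hline
  rw [hFF'] at hplot
  obtain ⟨q, hq, hev⟩ := hplot (c 0)
  -- a nonzero time at which the local description of the line is valid
  obtain ⟨t, ht, ht0⟩ : ∃ t : ℝ, F (t • α) = q (c t) ∧ t ≠ 0 := by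
    have h1 : ∀ᶠ t in 𝓝[≠] (0 : ℝ), F (t • α) = q (c t) := by
      refine nhdsWithin_le_nhds ?_
      filter_upwards [hc.continuousAt.eventually hev] with t ht
      simpa [c] using ht
    exact (h1.and self_mem_nhdsWithin).exists
  rcases hq with ⟨p, -, rfl⟩ | ⟨z, rfl⟩
  · refine ⟨t⁻¹ • p (c t), ?_⟩
    rw [map_smul]
    change t⁻¹ • (F' ∘ p) (c t) = F α
    rw [← ht, map_smul, smul_smul, inv_mul_cancel₀ ht0, one_smul]
  · have hz : z = 0 := by
      have := hev.self_of_nhds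
      simpa [c] using this.symm
    refine ⟨0, ?_⟩
    rw [hz, map_smul] at ht
    rw [map_zero, (smul_eq_zero.mp ht).resolve_left ht0]

theorem exists_plot_lift {F : Omega1 V →ₗ[ℝ] Omega1 Z} {F' : Omega1 W →ₗ[ℝ] Omega1 Z}
    (hFF' : pushforward F = pushforward F') {m : ℕ} {θ : E m → Omega1 V} (hθ : IsPlot θ)
    (r₀ : E m) : ∃ θ' : E m → Omega1 W, IsPlot θ' ∧ ∀ᶠ r in 𝓝 r₀, F' (θ' r) = F (θ r) := by
  have hplot := @dSmooth_pushforward _ _ _ F m _ hθ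
  rw [hFF'] at hplot
  obtain ⟨q, ⟨p, hp, rfl⟩ | ⟨z, rfl⟩, hev⟩ := hplot r₀
  · exact ⟨p, hp, hev.mono fun r hr => hr.symm⟩
  · obtain ⟨β, hβ⟩ := exists_pullback_eq hFF' (θ r₀)
    refine ⟨fun _ => β, isPlot_const, hev.mono fun r hr => ?_⟩
    have h₀ : F (θ r₀) = z := hev.self_of_nhds
    rw [hβ, h₀]
    exact hr.symm

end Pushforward

/-! ### Points and plots of the glued space -/

section Glue

variable {X₁ : Type u} {X₂ : Type v} {Y : Set X₁} {f : Y → X₂}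

/-- The equivalence relation generated by `GlueRel f`, when `f` is injective. -/
def GlueEquiv (f : Y → X₂) : X₁ ⊕ X₂ → X₁ ⊕ X₂ → Prop
  | .inl x, .inl x' => x = x'
  | .inl x, .inr z => ∃ y : Y, y.1 = x ∧ f y = z
  | .inr z, .inl x => ∃ y : Y, y.1 = x ∧ f y = z
  | .inr z, .inr z' => z = z'

theorem glueEquiv_equivalence (hf : Function.Injective f) : Equivalence (GlueEquiv f) where
  refl := by rintro (x | z) <;> rfl
  symm := by rintro (x | z) (x' | z') h <;> first | exact h | exact Eq.symm h
  trans := by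
    rintro (x | z) (x' | z') (x'' | z'') h h'
    · exact Eq.trans h h'
    · obtain rfl : x = x' := h
      exact h'
    · obtain ⟨y, rfl, rfl⟩ := h
      obtain ⟨y', rfl, h'⟩ := h'
      exact congrArg Subtype.val (hf h').symm
    · obtain rfl : z' = z'' := h'
      exact h
    · obtain rfl : x' = x'' := h'
      exact h
    · obtain ⟨y, rfl, rfl⟩ := h
      obtain ⟨y', h', rfl⟩ := h'
      exact congrArg f (Subtype.ext h'.symm)
    · obtain rfl : z = z' := h
      exact h'
    · exact Eq.trans h h'

theorem glue_eq_iff (hf : Function.Injective f) {a b : X₁ ⊕ X₂} :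
    (Quot.mk (GlueRel f) a = Quot.mk (GlueRel f) b) ↔ GlueEquiv f a b := by
  constructor
  · intro h
    have h' := Quot.eqvGen_exact h
    rw [← (glueEquiv_equivalence hf).eqvGen_iff]
    refine Relation.EqvGen.mono (r := GlueRel f) ?_ _ _ h'
    rintro _ _ ⟨y⟩
    exact ⟨y, rfl, rfl⟩
  · rcases a with x | z <;> rcases b with x' | z' <;> intro h
    · exact congrArg _ (congrArg _ h)
    · obtain ⟨y, rfl, rfl⟩ := h
      exact Quot.sound (GlueRel.glue y)
    · obtain ⟨y, rfl, rfl⟩ := h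
      exact (Quot.sound (GlueRel.glue y)).symm
    · exact congrArg _ (congrArg _ h)

theorem glue₁_injective (hf : Function.Injective f) : Function.Injective (glue₁ f) :=
  fun _ _ h => (glue_eq_iff hf).mp h

theorem glue₂_injective (hf : Function.Injective f) : Function.Injective (glue₂ f) :=
  fun _ _ h => (glue_eq_iff hf).mp h

theorem exists_of_glue₁_eq_glue₂ (hf : Function.Injective f) {x : X₁} {z : X₂}
    (h : glue₁ f x = glue₂ f z) : ∃ y : Y, y.1 = x ∧ f y = z :=
  (glue_eq_iff hf).mp h

theorem exists_glue_rep (z : Glue f) : (∃ x, glue₁ f x = z) ∨ ∃ x, glue₂ f x = z := by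
  obtain ⟨x | x, rfl⟩ := Quot.exists_rep z
  · exact Or.inl ⟨x, rfl⟩
  · exact Or.inr ⟨x, rfl⟩

variable [DiffeologicalSpace X₁] [DiffeologicalSpace X₂]

/-- A plot of the glued space locally comes from one of the two pieces. -/
theorem exists_glue_plot {n : ℕ} {p : E n → Glue f} (hp : IsPlot p) (r : E n) :
    (∃ q : Plot X₁ n, p =ᶠ[𝓝 r] glue₁ f ∘ q.1) ∨ ∃ q : Plot X₂ n, p =ᶠ[𝓝 r] glue₂ f ∘ q.1 := by
  obtain ⟨_, ⟨q, hq, rfl⟩ | ⟨z, rfl⟩, h⟩ := hp r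
  · obtain ⟨_, ⟨q', hq', rfl⟩ | ⟨q', hq', rfl⟩, h'⟩ := hq r
    · exact Or.inl ⟨⟨q', hq'⟩, h.trans (h'.mono fun _ hs => congrArg (Quot.mk _) hs)⟩
    · exact Or.inr ⟨⟨q', hq'⟩, h.trans (h'.mono fun _ hs => congrArg (Quot.mk _) hs)⟩
  · obtain ⟨x, rfl⟩ | ⟨x, rfl⟩ := exists_glue_rep z
    · exact Or.inl ⟨⟨fun _ => x, isPlot_const⟩, h⟩
    · exact Or.inr ⟨⟨fun _ => x, isPlot_const⟩, h⟩

/-- The image in the glued space of a plot of the first piece. -/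
abbrev gluePlot₁ (f : Y → X₂) {n : ℕ} (q : Plot X₁ n) : Plot (Glue f) n :=
  ⟨glue₁ f ∘ q.1, dSmooth_glue₁ f n q.1 q.2⟩

/-- The image in the glued space of a plot of the second piece. -/
abbrev gluePlot₂ (f : Y → X₂) {n : ℕ} (q : Plot X₂ n) : Plot (Glue f) n :=
  ⟨glue₂ f ∘ q.1, dSmooth_glue₂ f n q.1 q.2⟩

/-! ### Forms on the glued space -/

theorem pullback_glue_compatible (hf : IsDiffeoOntoImage f) (α : Omega1 (Glue f)) :
    pullback Subtype.val (dSmooth_val Y) (pullback (glue₁ f) (dSmooth_glue₁ f) α) =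
      pullback f hf.smooth (pullback (glue₂ f) (dSmooth_glue₂ f) α) := by
  refine omega_ext fun n p r => omega_congr α (Filter.Eventually.of_forall fun s => ?_)
  exact glue₁_eq f (p.1 s)

/-- Two forms which agree over `Y` agree on plots of the two pieces with the same image in the
glued space. Such plots take values in `Y` and `f(Y)` near the point in question, hence give a plot
of `Y` after shrinking. -/
theorem omega_eq_of_glue_eq (hf : IsDiffeoOntoImage f) {α₁ : Omega1 X₁} {α₂ : Omega1 X₂}
    (h : pullback Subtype.val (dSmooth_val Y) α₁ = pullback f hf.smooth α₂) {n : ℕ}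
    {q₁ : Plot X₁ n} {q₂ : Plot X₂ n} {r : E n}
    (hq : glue₁ f ∘ q₁.1 =ᶠ[𝓝 r] glue₂ f ∘ q₂.1) : α₁.1 n q₁ r = α₂.1 n q₂ r := by
  obtain ⟨U, hU, hUo, hrU⟩ := eventually_nhds_iff.mp hq
  obtain ⟨φ, hφ, hφU, hφr⟩ := exists_squash hUo hrU
  choose y hy₁ hy₂ using fun s => exists_of_glue₁_eq_glue₂ hf.injective (hU (φ s) (hφU s))
  have hy : IsPlot y := by
    change IsPlot (Subtype.val ∘ y)
    rw [show Subtype.val ∘ y = q₁.1 ∘ φ from funext hy₁]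
    exact isPlot_reparam q₁.2 hφ
  have h' := congrFun (congrFun (congrFun (congrArg Subtype.val h) n) ⟨y, hy⟩) r
  refine Eq.trans (omega_congr α₁ ?_) (h'.trans (omega_congr α₂ ?_))
  · filter_upwards [hφr] with s hs
    change q₁.1 s = (y s).1
    rw [hy₁, hs]
  · filter_upwards [hφr] with s hs
    change f (y s) = q₂.1 s
    rw [hy₂, hs]

/-- Forms on the two pieces that agree over `Y` glue to a form. -/
theorem exists_glue_form (hf : IsDiffeoOntoImage f) {α₁ : Omega1 X₁} {α₂ : Omega1 X₂}
    (h : pullback Subtype.val (dSmooth_val Y) α₁ = pullback f hf.smooth α₂) :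
    ∃ α : Omega1 (Glue f), pullback (glue₁ f) (dSmooth_glue₁ f) α = α₁ ∧
      pullback (glue₂ f) (dSmooth_glue₂ f) α = α₂ := by
  have hval : ∀ (n : ℕ) (p : Plot (Glue f) n) (r : E n), ∃ L : E n →L[ℝ] ℝ,
      (∀ q : Plot X₁ n, p.1 =ᶠ[𝓝 r] glue₁ f ∘ q.1 → α₁.1 n q r = L) ∧
      (∀ q : Plot X₂ n, p.1 =ᶠ[𝓝 r] glue₂ f ∘ q.1 → α₂.1 n q r = L) := by
    intro n p r
    obtain ⟨q, hq⟩ | ⟨q, hq⟩ := exists_glue_plot p.2 r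
    · refine ⟨α₁.1 n q r, fun q' hq' => omega_congr α₁ ?_, fun q' hq' =>
        (omega_eq_of_glue_eq hf h (hq.symm.trans hq')).symm⟩
      exact (hq'.symm.trans hq).mono fun s hs => glue₁_injective hf.injective hs
    · refine ⟨α₂.1 n q r, fun q' hq' => omega_eq_of_glue_eq hf h (hq'.symm.trans hq),
        fun q' hq' => omega_congr α₂ ?_⟩
      exact (hq'.symm.trans hq).mono fun s hs => glue₂_injective hf.injective hs
  choose L hL₁ hL₂ using hval
  refine ⟨⟨L, fun n p => contDiff_iff_contDiffAt.mpr fun r => ?_, fun n m p φ hφ r => ?_⟩,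
    omega_ext fun n p r => (hL₁ n (gluePlot₁ f p) r p Filter.EventuallyEq.rfl).symm,
    omega_ext fun n p r => (hL₂ n (gluePlot₂ f p) r p Filter.EventuallyEq.rfl).symm⟩
  · obtain ⟨q, hq⟩ | ⟨q, hq⟩ := exists_glue_plot p.2 r
    · refine (α₁.2.1 n q).contDiffAt.congr_of_eventuallyEq ?_
      filter_upwards [hq.eventuallyEq_nhds] with s hs
      exact (hL₁ n p s q hs).symm
    · refine (α₂.2.1 n q).contDiffAt.congr_of_eventuallyEq ?_
      filter_upwards [hq.eventuallyEq_nhds] with s hs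
      exact (hL₂ n p s q hs).symm
  · obtain ⟨q, hq⟩ | ⟨q, hq⟩ := exists_glue_plot p.2 (φ r)
    · rw [← hL₁ m p (φ r) q hq, ← α₁.2.2 n m q φ hφ r]
      exact (hL₁ n ⟨p.1 ∘ φ, isPlot_reparam p.2 hφ⟩ r ⟨q.1 ∘ φ, isPlot_reparam q.2 hφ⟩
        (hφ.continuous.continuousAt.eventually hq)).symm
    · rw [← hL₂ m p (φ r) q hq, ← α₂.2.2 n m q φ hφ r]
      exact (hL₂ n ⟨p.1 ∘ φ, isPlot_reparam p.2 hφ⟩ r ⟨q.1 ∘ φ, isPlot_reparam q.2 hφ⟩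
        (hφ.continuous.continuousAt.eventually hq)).symm

/-- A family of forms on the glued space is smooth if its restrictions to the two pieces are. -/
theorem isPlot_glue_form {m : ℕ} {θ : E m → Omega1 (Glue f)}
    (h₁ : IsPlot fun s => pullback (glue₁ f) (dSmooth_glue₁ f) (θ s))
    (h₂ : IsPlot fun s => pullback (glue₂ f) (dSmooth_glue₂ f) (θ s)) : IsPlot θ := by
  intro n p
  refine contDiff_iff_contDiffAt.mpr fun ⟨s, r⟩ => ?_
  obtain ⟨q, hq⟩ | ⟨q, hq⟩ := exists_glue_plot p.2 r
  · refine (h₁ n q).contDiffAt.congr_of_eventuallyEq ?_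
    filter_upwards [continuous_snd.continuousAt.eventually hq.eventuallyEq_nhds] with z hz
    exact omega_congr (q := gluePlot₁ f q) (θ z.1) hz
  · refine (h₂ n q).contDiffAt.congr_of_eventuallyEq ?_
    filter_upwards [continuous_snd.continuousAt.eventually hq.eventuallyEq_nhds] with z hz
    exact omega_congr (q := gluePlot₂ f q) (θ z.1) hz

/-- Smooth families of forms on the two pieces that agree over `Y` near a parameter glue, near that
parameter, to a smooth family. -/
theorem exists_glue_form_plot (hf : IsDiffeoOntoImage f) {m : ℕ} {θ₁ : E m → Omega1 X₁}
    {θ₂ : E m → Omega1 X₂} (h₁ : IsPlot θ₁) (h₂ : IsPlot θ₂) {r₀ : E m}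
    (h : ∀ᶠ r in 𝓝 r₀, pullback Subtype.val (dSmooth_val Y) (θ₁ r) =
      pullback f hf.smooth (θ₂ r)) :
    ∃ θ : E m → Omega1 (Glue f), IsPlot θ ∧
      ∀ᶠ r in 𝓝 r₀, pullback (glue₁ f) (dSmooth_glue₁ f) (θ r) = θ₁ r ∧
        pullback (glue₂ f) (dSmooth_glue₂ f) (θ r) = θ₂ r := by
  obtain ⟨U, hU, hUo, hrU⟩ := eventually_nhds_iff.mp h
  obtain ⟨φ, hφ, hφU, hφr⟩ := exists_squash hUo hrU
  choose θ e₁ e₂ using fun r => exists_glue_form hf (hU (φ r) (hφU r))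
  refine ⟨θ, isPlot_glue_form ?_ ?_, ?_⟩
  · rw [funext e₁]
    exact isPlot_reparam h₁ hφ
  · rw [funext e₂]
    exact isPlot_reparam h₂ hφ
  · filter_upwards [hφr] with r hr
    exact ⟨(e₁ r).trans (congrArg θ₁ hr), (e₂ r).trans (congrArg θ₂ hr)⟩

/-! ### The fibres over the glued space -/

/-- Elements of `Λ¹_y(X₁)` restricting to zero over `Y` are orthogonal to everything, since every
element has a compatible partner and `0` is a partner of an element restricting to zero. -/
theorem res₁_injective (hf : IsDiffeoOntoImage f)
    (hΩ : restrictionDiffeology₁ Y = restrictionDiffeology₂ hf) {g₁ : PseudoMetric X₁}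
    {g₂ : PseudoMetric X₂} (hg : CompatibleMetrics hf g₁ g₂) (y : Y) :
    Function.Injective (res₁ y) := by
  refine (injective_iff_map_eq_zero _).mpr fun v hv => g₁.eq_zero_of_forall fun w => ?_
  obtain ⟨α, rfl⟩ := (vanishing y.1).mkQ_surjective w
  obtain ⟨β, hβ⟩ := exists_pullback_eq hΩ α
  have hβ' : CompatibleElements hf y (val y.1 α) (val (f y) β) := congrArg (val y) hβ.symm
  rw [hg y v _ 0 _ (hv.trans (map_zero _).symm) hβ', map_zero, LinearMap.zero_apply]

theorem res₂_injective (hf : IsDiffeoOntoImage f)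
    (hΩ : restrictionDiffeology₁ Y = restrictionDiffeology₂ hf) {g₁ : PseudoMetric X₁}
    {g₂ : PseudoMetric X₂} (hg : CompatibleMetrics hf g₁ g₂) (y : Y) :
    Function.Injective (res₂ hf y) := by
  refine (injective_iff_map_eq_zero _).mpr fun v hv => g₂.eq_zero_of_forall fun w => ?_
  obtain ⟨α, rfl⟩ := (vanishing (f y)).mkQ_surjective w
  obtain ⟨β, hβ⟩ := exists_pullback_eq hΩ.symm α
  have hβ' : CompatibleElements hf y (val y.1 β) (val (f y) α) := congrArg (val y) hβ
  rw [← hg y 0 _ v _ ((map_zero _).trans hv.symm) hβ', map_zero, LinearMap.zero_apply]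

theorem res₁_comp_rho₁ (hf : IsDiffeoOntoImage f) (y : Y) {z : Glue f} (h₁ : glue₁ f y = z)
    (h₂ : glue₂ f (f y) = z) :
    res₁ y ∘ₗ rho₁ f y z h₁ = res₂ hf y ∘ₗ rho₂ f (f y) z h₂ := by
  refine LinearMap.ext fun v => ?_
  obtain ⟨α, rfl⟩ := (vanishing z).mkQ_surjective v
  exact congrArg (val y) (pullback_glue_compatible hf α)

theorem compatibleElements_rho (hf : IsDiffeoOntoImage f) (y : Y) {z : Glue f}
    (h₁ : glue₁ f y = z) (h₂ : glue₂ f (f y) = z) (v : Lam z) :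
    CompatibleElements hf y (rho₁ f y z h₁ v) (rho₂ f (f y) z h₂ v) :=
  LinearMap.congr_fun (res₁_comp_rho₁ hf y h₁ h₂) v

theorem inducesLamIso_glue₁ (hf : IsDiffeoOntoImage f)
    (hΩ : restrictionDiffeology₁ Y = restrictionDiffeology₂ hf)
    (hr : ∀ y, Function.Injective (res₂ hf y)) :
    InducesLamIso (glue₁ f) (dSmooth_glue₁ f) where
  lift := by
    intro m θ hθ r₀
    obtain ⟨θ₂, hθ₂, h⟩ := exists_plot_lift hΩ hθ r₀
    obtain ⟨θ', hθ', h'⟩ := exists_glue_form_plot hf hθ hθ₂ (h.mono fun _ h => h.symm)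
    exact ⟨θ', hθ', h'.mono fun _ h => h.1⟩
  injective := by
    rintro x _ rfl
    refine (injective_iff_map_eq_zero _).mpr fun v hv => ?_
    obtain ⟨α, rfl⟩ := (vanishing (glue₁ f x)).mkQ_surjective v
    refine val_eq_zero_iff.mpr fun n p hp => ?_
    obtain ⟨q, hq⟩ | ⟨q, hq⟩ := exists_glue_plot p.2 0
    · rw [omega_congr (q := gluePlot₁ f q) α hq]
      exact val_eq_zero_iff.mp hv n q
        (glue₁_injective hf.injective (hq.self_of_nhds.symm.trans hp))
    · obtain ⟨y, rfl, hy⟩ := exists_of_glue₁_eq_glue₂ hf.injective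
        (hp.symm.trans hq.self_of_nhds)
      have h₂ : rho₂ f (f y) (glue₁ f y) (glue₁_eq f y).symm (val _ α) = 0 := by
        apply hr y
        rw [← compatibleElements_rho hf y rfl (glue₁_eq f y).symm (val _ α), map_zero]
        exact (congrArg (res₁ y) hv).trans (map_zero _)
      rw [omega_congr (q := gluePlot₂ f q) α hq]
      exact val_eq_zero_iff.mp h₂ n q hy.symm

theorem inducesLamIso_glue₂ (hf : IsDiffeoOntoImage f)
    (hΩ : restrictionDiffeology₁ Y = restrictionDiffeology₂ hf)
    (hr : ∀ y : Y, Function.Injective (res₁ y)) :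
    InducesLamIso (glue₂ f) (dSmooth_glue₂ f) where
  lift := by
    intro m θ hθ r₀
    obtain ⟨θ₁, hθ₁, h⟩ := exists_plot_lift hΩ.symm hθ r₀
    obtain ⟨θ', hθ', h'⟩ := exists_glue_form_plot hf hθ₁ hθ h
    exact ⟨θ', hθ', h'.mono fun _ h => h.2⟩
  injective := by
    rintro x _ rfl
    refine (injective_iff_map_eq_zero _).mpr fun v hv => ?_
    obtain ⟨α, rfl⟩ := (vanishing (glue₂ f x)).mkQ_surjective v
    refine val_eq_zero_iff.mpr fun n p hp => ?_
    obtain ⟨q, hq⟩ | ⟨q, hq⟩ := exists_glue_plot p.2 0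
    · obtain ⟨y, hy, rfl⟩ := exists_of_glue₁_eq_glue₂ hf.injective
        (hq.self_of_nhds.symm.trans hp)
      have h₁ : rho₁ f y (glue₂ f (f y)) (glue₁_eq f y) (val _ α) = 0 := by
        apply hr y
        rw [compatibleElements_rho hf y (glue₁_eq f y) rfl (val _ α), map_zero]
        exact (congrArg (res₂ hf y) hv).trans (map_zero _)
      rw [omega_congr (q := gluePlot₁ f q) α hq]
      exact val_eq_zero_iff.mp h₁ n q hy.symm
    · rw [omega_congr (q := gluePlot₂ f q) α hq]
      exact val_eq_zero_iff.mp hv n q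
        (glue₂_injective hf.injective (hq.self_of_nhds.symm.trans hp))

/-! ### The induced pseudo-metric -/

/-- Over the common part the pullbacks of compatible pseudo-metrics coincide, so that there is a
pseudo-metric on the glued space restricting to the given ones on both pieces. -/
theorem exists_glue_metric (hf : IsDiffeoOntoImage f) {g₁ : PseudoMetric X₁}
    {g₂ : PseudoMetric X₂} (hg : CompatibleMetrics hf g₁ g₂)
    (H₁ : InducesLamIso (glue₁ f) (dSmooth_glue₁ f))
    (H₂ : InducesLamIso (glue₂ f) (dSmooth_glue₂ f)) :
    ∃ g : PseudoMetric (Glue f), PullsBackTo (dSmooth_glue₁ f) g g₁ ∧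
      PullsBackTo (dSmooth_glue₂ f) g g₂ := by
  have hform : ∀ z : Glue f, ∃ B : Lam z →ₗ[ℝ] Lam z →ₗ[ℝ] ℝ,
      (∀ (x : X₁) (hx : glue₁ f x = z) (v w : Lam z),
        B v w = g₁.form x (rho₁ f x z hx v) (rho₁ f x z hx w)) ∧
      (∀ (x : X₂) (hx : glue₂ f x = z) (v w : Lam z),
        B v w = g₂.form x (rho₂ f x z hx v) (rho₂ f x z hx w)) := by
    intro z
    obtain ⟨x, rfl⟩ | ⟨x, rfl⟩ := exists_glue_rep z
    · refine ⟨(g₁.form x).compl₁₂ (rho₁ f x _ rfl) (rho₁ f x _ rfl), fun x' hx' v w => ?_,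
        fun x' hx' v w => ?_⟩
      · obtain rfl := glue₁_injective hf.injective hx'
        rfl
      · obtain ⟨y, rfl, rfl⟩ := exists_of_glue₁_eq_glue₂ hf.injective hx'.symm
        exact hg y _ _ _ _ (compatibleElements_rho hf y _ _ v)
          (compatibleElements_rho hf y _ _ w)
    · refine ⟨(g₂.form x).compl₁₂ (rho₂ f x _ rfl) (rho₂ f x _ rfl), fun x' hx' v w => ?_,
        fun x' hx' v w => ?_⟩
      · obtain ⟨y, rfl, rfl⟩ := exists_of_glue₁_eq_glue₂ hf.injective hx'
        exact (hg y _ _ _ _ (compatibleElements_rho hf y _ _ v)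
          (compatibleElements_rho hf y _ _ w)).symm
      · obtain rfl := glue₂_injective hf.injective hx'
        rfl
  choose B hB₁ hB₂ using hform
  have hfin : ∀ z : Glue f, Module.Finite ℝ (Lam z) := by
    intro z
    obtain ⟨x, hx⟩ | ⟨x, hx⟩ := exists_glue_rep z
    · have := g₁.finite x
      exact Module.Finite.of_injective _ (H₁.injective x z hx)
    · have := g₂.finite x
      exact Module.Finite.of_injective _ (H₂.injective x z hx)
  have hker : ∀ z : Glue f, LinearMap.ker (B z) = ⊥ := by
    intro z
    refine (Submodule.eq_bot_iff _).mpr fun v hv => ?_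
    obtain ⟨x, hx⟩ | ⟨x, hx⟩ := exists_glue_rep z
    · refine (injective_iff_map_eq_zero _).mp (H₁.injective x z hx) v
        (g₁.eq_zero_of_forall fun w => ?_)
      obtain ⟨w, rfl⟩ := H₁.surjective x z hx w
      exact (hB₁ z x hx v w).symm.trans (LinearMap.congr_fun hv w)
    · refine (injective_iff_map_eq_zero _).mp (H₂.injective x z hx) v
        (g₂.eq_zero_of_forall fun w => ?_)
      obtain ⟨w, rfl⟩ := H₂.surjective x z hx w
      exact (hB₂ z x hx v w).symm.trans (LinearMap.congr_fun hv w)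
  refine ⟨⟨B, hfin, fun z v w => ?_, fun z v => ?_, fun z => ?_, fun n b v w hv hw => ?_⟩,
    fun x v w => hB₁ _ x rfl v w, fun x v w => hB₂ _ x rfl v w⟩
  · obtain ⟨x, hx⟩ | ⟨x, hx⟩ := exists_glue_rep z
    · rw [hB₁ z x hx, hB₁ z x hx, g₁.symm]
    · rw [hB₂ z x hx, hB₂ z x hx, g₂.symm]
  · obtain ⟨x, hx⟩ | ⟨x, hx⟩ := exists_glue_rep z
    · rw [hB₁ z x hx]
      exact g₁.nonneg x _
    · rw [hB₂ z x hx]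
      exact g₂.nonneg x _
  · have := hfin z
    rw [hker z, smoothDual_eq_top, finrank_top, Subspace.dual_finrank_eq, finrank_bot, zero_add]
  · refine contDiff_iff_contDiffAt.mpr fun r₀ => ?_
    obtain ⟨hb, hv⟩ := smoothAlong_iff.mp hv
    obtain ⟨θ, hθ, hv⟩ := hv r₀
    obtain ⟨η, hη, hw⟩ := (smoothAlong_iff.mp hw).2 r₀
    obtain ⟨q, hq⟩ | ⟨q, hq⟩ := exists_glue_plot hb r₀
    · refine (g₁.smooth n q.1 _ _
        (smoothAlong_iff.mpr ⟨q.2, fun _ => ⟨_, isPlot_pullback (dSmooth_glue₁ f) hθ,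
          Filter.Eventually.of_forall fun _ => rfl⟩⟩)
        (smoothAlong_iff.mpr ⟨q.2, fun _ => ⟨_, isPlot_pullback (dSmooth_glue₁ f) hη,
          Filter.Eventually.of_forall fun _ => rfl⟩⟩)).contDiffAt.congr_of_eventuallyEq ?_
      filter_upwards [hv, hw, hq] with r hvr hwr hqr
      rw [hvr, hwr, hB₁ _ (q.1 r) hqr.symm]
      rfl
    · refine (g₂.smooth n q.1 _ _
        (smoothAlong_iff.mpr ⟨q.2, fun _ => ⟨_, isPlot_pullback (dSmooth_glue₂ f) hθ,
          Filter.Eventually.of_forall fun _ => rfl⟩⟩)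
        (smoothAlong_iff.mpr ⟨q.2, fun _ => ⟨_, isPlot_pullback (dSmooth_glue₂ f) hη,
          Filter.Eventually.of_forall fun _ => rfl⟩⟩)).contDiffAt.congr_of_eventuallyEq ?_
      filter_upwards [hv, hw, hq] with r hvr hwr hqr
      rw [hvr, hwr, hB₂ _ (q.1 r) hqr.symm]
      rfl

theorem isInducedMetric_of_pullsBackTo (hf : IsDiffeoOntoImage f) {g₁ : PseudoMetric X₁}
    {g₂ : PseudoMetric X₂} (hg : CompatibleMetrics hf g₁ g₂) {g : PseudoMetric (Glue f)}
    (h₁ : PullsBackTo (dSmooth_glue₁ f) g g₁) (h₂ : PullsBackTo (dSmooth_glue₂ f) g g₂) :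
    IsInducedMetric f g₁ g₂ g where
  left x _ := h₁ x
  right x _ := h₂ x
  common y v w := by
    rw [h₂ (f y) v w, hg y _ _ _ _ (compatibleElements_rho hf y (glue₁_eq f y) rfl v)
      (compatibleElements_rho hf y (glue₁_eq f y) rfl w)]
    change _ = (1 / 2 : ℝ) * (g₂.form (f y) (rho₂ f (f y) _ rfl v) (rho₂ f (f y) _ rfl w) + _)
    rw [← two_mul, ← mul_assoc]
    norm_num
    rfl

/-! ### The induced connection -/

theorem isInducedOperator_iff {D₁ : Connection X₁} {D₂ : Connection X₂}
    {D : Sections (Glue f) → ∀ z : Glue f, Lam2 z} :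
    IsInducedOperator f D₁ D₂ D ↔
      RestrictsTo (dSmooth_glue₁ f) D D₁ ∧ RestrictsTo (dSmooth_glue₂ f) D D₂ := by
  constructor
  · intro h
    refine ⟨fun s x z hz => ?_, fun s x z hz => ?_⟩
    · by_cases hx : x ∈ Y
      · obtain rfl : glue₂ f (f ⟨x, hx⟩) = z := (glue₁_eq f ⟨x, hx⟩).symm.trans hz
        exact h.common₁ s ⟨x, hx⟩
      · subst hz
        exact h.left s x hx
    · subst hz
      by_cases hx : x ∈ Set.range f
      · obtain ⟨y, rfl⟩ := hx
        exact h.common₂ s y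
      · exact h.right s x hx
  · rintro ⟨h₁, h₂⟩
    exact ⟨fun s x _ => h₁ s x _ rfl, fun s x _ => h₂ s x _ rfl,
      fun s y => h₁ s y _ (glue₁_eq f y), fun s y => h₂ s (f y) _ rfl⟩

/-- An operator on sections over the glued space is determined by its restrictions to the two
pieces. -/
theorem operator_unique (H₁ : InducesLamIso (glue₁ f) (dSmooth_glue₁ f))
    (H₂ : InducesLamIso (glue₂ f) (dSmooth_glue₂ f)) {D₁ : Connection X₁} {D₂ : Connection X₂}
    {D D' : Sections (Glue f) → ∀ z : Glue f, Lam2 z}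
    (h₁ : RestrictsTo (dSmooth_glue₁ f) D D₁) (h₂ : RestrictsTo (dSmooth_glue₂ f) D D₂)
    (h₁' : RestrictsTo (dSmooth_glue₁ f) D' D₁) (h₂' : RestrictsTo (dSmooth_glue₂ f) D' D₂)
    (s : Sections (Glue f)) (z : Glue f) : D s z = D' s z := by
  obtain ⟨x, hx⟩ | ⟨x, hx⟩ := exists_glue_rep z
  · exact (H₁.map_bijective x z hx).1 ((h₁ s x z hx).trans (h₁' s x z hx).symm)
  · exact (H₂.map_bijective x z hx).1 ((h₂ s x z hx).trans (h₂' s x z hx).symm)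

/-- Over `Y` the tensors prescribed by compatible connections come from one and the same tensor on
the glued space, because their images over `Y` agree and restriction to `Y` is injective. -/
theorem exists_glue_operator (hf : IsDiffeoOntoImage f)
    (hr₁ : ∀ y : Y, Function.Injective (res₁ y)) (hr₂ : ∀ y, Function.Injective (res₂ hf y))
    (H₁ : InducesLamIso (glue₁ f) (dSmooth_glue₁ f))
    (H₂ : InducesLamIso (glue₂ f) (dSmooth_glue₂ f)) {D₁ : Connection X₁} {D₂ : Connection X₂}
    (hD : CompatibleConnections hf D₁ D₂) :
    ∃ D : Sections (Glue f) → ∀ z : Glue f, Lam2 z,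
      RestrictsTo (dSmooth_glue₁ f) D D₁ ∧ RestrictsTo (dSmooth_glue₂ f) D D₂ := by
  have hcomp : ∀ s : Sections (Glue f), CompatibleSections hf (pullSection (dSmooth_glue₁ f) s)
      (pullSection (dSmooth_glue₂ f) s) := by
    intro s y
    change res₁ y (rho₁ f y _ rfl (s.1 (glue₁ f y))) =
      res₂ hf y (rho₂ f (f y) _ rfl (s.1 (glue₂ f (f y))))
    have : ∀ z (hz : glue₁ f y = z), res₁ y (rho₁ f y _ rfl (s.1 (glue₁ f y))) =
        res₁ y (rho₁ f y z hz (s.1 z)) := by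
      rintro _ rfl
      rfl
    rw [this _ (glue₁_eq f y)]
    exact compatibleElements_rho hf y _ _ _
  -- the two prescriptions over a common point are equivalent
  have key : ∀ (s : Sections (Glue f)) (y : Y) (z : Glue f) (h₁ : glue₁ f y = z)
      (h₂ : glue₂ f (f y) = z) (T : Lam2 z),
      TensorProduct.map (rho₁ f y z h₁) (rho₁ f y z h₁) T =
          (D₁.op (pullSection (dSmooth_glue₁ f) s)).1 y ↔
        TensorProduct.map (rho₂ f (f y) z h₂) (rho₂ f (f y) z h₂) T =
          (D₂.op (pullSection (dSmooth_glue₂ f) s)).1 (f y) := by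
    intro s y z h₁ h₂ T
    have e : TensorProduct.map (res₁ y) (res₁ y)
        (TensorProduct.map (rho₁ f y z h₁) (rho₁ f y z h₁) T) =
        TensorProduct.map (res₂ hf y) (res₂ hf y)
          (TensorProduct.map (rho₂ f (f y) z h₂) (rho₂ f (f y) z h₂) T) := by
      rw [← LinearMap.comp_apply, ← TensorProduct.map_comp, res₁_comp_rho₁ hf y h₁ h₂,
        TensorProduct.map_comp, LinearMap.comp_apply]
    have i₁ := TensorProduct.map_injective_of_flat_flat _ _ (hr₁ y) (hr₁ y)
    have i₂ := TensorProduct.map_injective_of_flat_flat _ _ (hr₂ y) (hr₂ y)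
    rw [← i₁.eq_iff, e, hD _ _ (hcomp s) y, i₂.eq_iff]
  have hT : ∀ (s : Sections (Glue f)) (z : Glue f), ∃ T : Lam2 z,
      (∀ (x : X₁) (hx : glue₁ f x = z), TensorProduct.map (rho₁ f x z hx) (rho₁ f x z hx) T =
        (D₁.op (pullSection (dSmooth_glue₁ f) s)).1 x) ∧
      (∀ (x : X₂) (hx : glue₂ f x = z), TensorProduct.map (rho₂ f x z hx) (rho₂ f x z hx) T =
        (D₂.op (pullSection (dSmooth_glue₂ f) s)).1 x) := by
    intro s z
    obtain ⟨x, rfl⟩ | ⟨x, rfl⟩ := exists_glue_rep z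
    · obtain ⟨T, hT⟩ := (H₁.map_bijective x _ rfl).2
        ((D₁.op (pullSection (dSmooth_glue₁ f) s)).1 x)
      refine ⟨T, fun x' hx' => ?_, fun x' hx' => ?_⟩
      · obtain rfl := glue₁_injective hf.injective hx'
        exact hT
      · obtain ⟨y, rfl, rfl⟩ := exists_of_glue₁_eq_glue₂ hf.injective hx'.symm
        exact (key s y _ rfl hx' T).mp hT
    · obtain ⟨T, hT⟩ := (H₂.map_bijective x _ rfl).2
        ((D₂.op (pullSection (dSmooth_glue₂ f) s)).1 x)
      refine ⟨T, fun x' hx' => ?_, fun x' hx' => ?_⟩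
      · obtain ⟨y, rfl, rfl⟩ := exists_of_glue₁_eq_glue₂ hf.injective hx'
        exact (key s y _ hx' rfl T).mpr hT
      · obtain rfl := glue₂_injective hf.injective hx'
        exact hT
  choose D h₁ h₂ using hT
  exact ⟨D, fun s x z hx => h₁ s z x hx, fun s x z hx => h₂ s z x hx⟩

/-- An operator restricting to connections on both pieces is a connection. -/
theorem exists_glue_connection (H₁ : InducesLamIso (glue₁ f) (dSmooth_glue₁ f))
    (H₂ : InducesLamIso (glue₂ f) (dSmooth_glue₂ f)) {D₁ : Connection X₁} {D₂ : Connection X₂}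
    {D : Sections (Glue f) → ∀ z : Glue f, Lam2 z}
    (h₁ : RestrictsTo (dSmooth_glue₁ f) D D₁) (h₂ : RestrictsTo (dSmooth_glue₂ f) D D₂) :
    ∃ D' : Connection (Glue f), ∀ s, (D'.op s).1 = D s := by
  have hsmooth : ∀ (m : ℕ) (q : E m → Sections (Glue f)), IsPlot q →
      ∀ (k : ℕ) (a : E k → E m) (p : E k → Glue f), ContDiff ℝ ∞ a → IsPlot p →
        IsPlot fun r => (⟨p r, D (q (a r)) (p r)⟩ : Lam2Total (Glue f)) := by
    intro m q hq k a p ha hp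
    refine isPlot_of_locally fun r₀ => ?_
    obtain ⟨b, hb⟩ | ⟨b, hb⟩ := exists_glue_plot hp r₀
    · refine ⟨fun r => ⟨glue₁ f (b.1 r), D (q (a r)) (glue₁ f (b.1 r))⟩, H₁.isPlot_lam2 ?_, ?_⟩
      · simp only [h₁ _ _ _ rfl]
        exact D₁.smooth _ _ (dSmooth_pullSection (dSmooth_glue₁ f) m q hq) k a b.1 ha b.2
      · filter_upwards [hb] with r hr
        rw [hr]
        rfl
    · refine ⟨fun r => ⟨glue₂ f (b.1 r), D (q (a r)) (glue₂ f (b.1 r))⟩, H₂.isPlot_lam2 ?_, ?_⟩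
      · simp only [h₂ _ _ _ rfl]
        exact D₂.smooth _ _ (dSmooth_pullSection (dSmooth_glue₂ f) m q hq) k a b.1 ha b.2
      · filter_upwards [hb] with r hr
        rw [hr]
        rfl
  have hsec : ∀ s, DSmooth fun z => (⟨z, D s z⟩ : Lam2Total (Glue f)) := fun s n p hp =>
    hsmooth n (fun _ => s) isPlot_const n id p contDiff_id hp
  refine ⟨⟨⟨⟨fun s => ⟨D s, hsec s⟩, fun s t => Subtype.ext (funext fun z => ?_)⟩,
    fun c s => Subtype.ext (funext fun z => ?_)⟩, fun m q hq => hsmooth m q hq,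
    fun k s z => ?_⟩, fun s => rfl⟩
  · change D (s + t) z = D s z + D t z
    obtain ⟨x, hx⟩ | ⟨x, hx⟩ := exists_glue_rep z
    · apply (H₁.map_bijective x z hx).1
      rw [map_add, h₁ _ _ _ hx, h₁ _ _ _ hx, h₁ _ _ _ hx, pullSection_add, map_add]
      rfl
    · apply (H₂.map_bijective x z hx).1
      rw [map_add, h₂ _ _ _ hx, h₂ _ _ _ hx, h₂ _ _ _ hx, pullSection_add, map_add]
      rfl
  · change D (c • s) z = c • D s z
    obtain ⟨x, hx⟩ | ⟨x, hx⟩ := exists_glue_rep z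
    · apply (H₁.map_bijective x z hx).1
      rw [map_smul, h₁ _ _ _ hx, h₁ _ _ _ hx, pullSection_smul, map_smul]
      rfl
    · apply (H₂.map_bijective x z hx).1
      rw [map_smul, h₂ _ _ _ hx, h₂ _ _ _ hx, pullSection_smul, map_smul]
      rfl
  · obtain ⟨x, rfl⟩ | ⟨x, rfl⟩ := exists_glue_rep z
    · exact H₁.leibniz h₁ k s x
    · exact H₂.leibniz h₂ k s x

end Glue

end DiffGlue

theorem mainTheorem5 {X₁ : Type*} {X₂ : Type*} [DiffeologicalSpace X₁] [DiffeologicalSpace X₂]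
    {Y : Set X₁} {f : Y → X₂} (hf : DiffGlue.IsDiffeoOntoImage f)
    (hΩ : DiffGlue.restrictionDiffeology₁ Y = DiffGlue.restrictionDiffeology₂ hf)
    (g₁ : DiffGlue.PseudoMetric X₁) (g₂ : DiffGlue.PseudoMetric X₂)
    (hg : DiffGlue.CompatibleMetrics hf g₁ g₂)
    (D₁ : DiffGlue.Connection X₁) (D₂ : DiffGlue.Connection X₂)
    (hD₁ : D₁.IsLeviCivita g₁) (hD₂ : D₂.IsLeviCivita g₂)
    (hD : DiffGlue.CompatibleConnections hf D₁ D₂) :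
    ∃ g : DiffGlue.PseudoMetric (DiffGlue.Glue f), DiffGlue.IsInducedMetric f g₁ g₂ g ∧
      ∃ D : DiffGlue.Connection (DiffGlue.Glue f),
        (∀ D' : DiffGlue.Sections (DiffGlue.Glue f) → ∀ z : DiffGlue.Glue f, DiffGlue.Lam2 z,
          DiffGlue.IsInducedOperator f D₁ D₂ D' ↔ ∀ s z, D' s z = (D.op s).1 z) ∧
        D.IsLeviCivita g := by
  have hr₁ := DiffGlue.res₁_injective hf hΩ hg
  have hr₂ := DiffGlue.res₂_injective hf hΩ hg
  have H₁ := DiffGlue.inducesLamIso_glue₁ hf hΩ hr₂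
  have H₂ := DiffGlue.inducesLamIso_glue₂ hf hΩ hr₁
  obtain ⟨g, hg₁, hg₂⟩ := DiffGlue.exists_glue_metric hf hg H₁ H₂
  obtain ⟨D₀, h₁, h₂⟩ := DiffGlue.exists_glue_operator hf hr₁ hr₂ H₁ H₂ hD
  obtain ⟨D, hDD₀⟩ := DiffGlue.exists_glue_connection H₁ H₂ h₁ h₂
  obtain rfl : (fun s => (D.op s).1) = D₀ := funext hDD₀
  refine ⟨g, DiffGlue.isInducedMetric_of_pullsBackTo hf hg hg₁ hg₂, D, fun D' => ?_, ?_, ?_⟩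
  · rw [DiffGlue.isInducedOperator_iff]
    refine ⟨fun h => DiffGlue.operator_unique H₁ H₂ h.1 h.2 h₁ h₂, fun h => ?_⟩
    obtain rfl : D' = fun s => (D.op s).1 := funext fun s => funext (h s)
    exact ⟨h₁, h₂⟩
  · intro s t z
    obtain ⟨x, rfl⟩ | ⟨x, rfl⟩ := DiffGlue.exists_glue_rep z
    · exact H₁.metric hg₁ h₁ hD₁.metric s t x
    · exact H₂.metric hg₂ h₂ hD₂.metric s t x
  · intro s t k z
    obtain ⟨x, rfl⟩ | ⟨x, rfl⟩ := DiffGlue.exists_glue_rep z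
    · exact hg₁.symmetric h₁ hD₁.symmetric s t k x
    · exact hg₂.symmetric h₂ hD₂.symmetric s t k x
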